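/- Let $X$ be a measurable space with countably generated $\sigma$-field $\mathscr B(X)$, let $P$ be a Markov transition kernel on $X$ and $\pi$ a probability measure on $X$. Assume that * $P$ is $\pi$-irreducible: if $\pi(B)>0$, then for every $x\in X$ there is an $n$ with $P^n(x,B)>0$; * $P$ is reversible with respect to $\pi$: $\pi(dx)P(x,dy)=\pi(dy)P(y,dx)$ (in particular $\pi$ is invariant); * $P$ is non-negative definite: $\int_X f(x)\,Pf(x)\,\pi(dx)\ge 0$ for all real $f\in L^2(\pi)$, where $Pf(x)=\int_X f(y)P(x,dy)$. Let $(\Phi_n)_{n\ge0}$ be the Markov chain with transition kernel $P$, let $\mathbb E_x$ denote expectation for the chain started at $\Phi_0=x$, and for $A\in\mathscr B(X)$ let $\tau_A=\inf\{n\ge1:\Phi_n\in A\}$ (with $\inf\emptyset=\infty$). Let $A$ be an accessible atom, i.e. $A\in\mathscr B(X)$, $\pi(A)>0$, and there is a probability measure $\nu$ with $P(x,B)=\nu(B)$ for all $x\in A$ and $B\in\mathscr B(X)$. Assume that for some $\kappa>1$ $$L:=\sup_{x\in A}\mathbb E_x[\kappa^{\tau_A}]<\infty\qquad(\kappa^\infty:=\infty).$$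 Write $\|\mu\|_{\mathrm{var}}=\sup_{|f|\le1}|\mu(f)|$ (supremum over measurable $f$) for a finite signed measure $\mu$, and let $r_0(P)$ be the spectral radius of the operator $f\mapsto Pf$ on the Hilbert space $\{f\in L^2(\pi):\pi(f)=0\}$ (real or complex). Then: 1. $r_0(P)\le\kappa^{-1}$. 2. For every $n\ge1$, $$\sup_{x\in A}\|P^n(x,\cdot)-\pi\|_{\mathrm{var}}\le\left(\pi(A)^{-1}-1\right)^{1/2}\kappa^{-n}.$$ 3. There is a function $C:X\to\mathbb R$ such that for $\pi$-almost every $x\in X$, for all $n\ge0$, $$\|P^n(x,\cdot)-\pi\|_{\mathrm{var}}\le C(x)\,\kappa^{-n}.$$ -/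

import Mathlib

open MeasureTheory ProbabilityTheory
open scoped ENNReal

namespace MarkovChain

variable {X : Type*} [MeasurableSpace X]

/-- The law of the time-homogeneous Markov chain with transition kernel `P` started at `x`,
as a probability measure on the space of trajectories `ℕ → X` (Ionescu-Tulcea). -/
noncomputable def law (P : Kernel X X) [IsMarkovKernel P] (x : X) : Measure (ℕ → X) :=
  Kernel.traj (X := fun _ => X)
    (fun n => P.comap (fun h : (Π _ : Finset.Iic n, X) => h ⟨n, Finset.mem_Iic.2 le_rfl⟩)
      (measurable_pi_apply _)) 0 (fun _ => x)

/-- The first return time `τ_A = inf {n ≥ 1 : Φ_n ∈ A}` of a trajectory, with `inf ∅ = ∞`. -/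
noncomputable def returnTime (A : Set X) (ω : ℕ → X) : ℕ∞ :=
  hittingAfter (fun n (ω : ℕ → X) => ω n) A 1 ω

/-- `κ ^ t` for `κ > 1` and `t ∈ ℕ ∪ {∞}`, with `κ ^ ∞ = ∞`. -/
noncomputable def geomPow (κ : ℝ) : ℕ∞ → ℝ≥0∞
  | none => ⊤
  | some n => ENNReal.ofReal κ ^ n

/-- The geometric moment `E_x[κ ^ τ_A]` of the first return time, for `κ > 1`. -/
noncomputable def geomMoment (P : Kernel X X) [IsMarkovKernel P] (A : Set X) (κ : ℝ) (x : X) :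
    ℝ≥0∞ :=
  ∫⁻ ω, geomPow κ (returnTime A ω) ∂(law P x)

/-- `A` is an accessible atom: a measurable set of positive `π`-measure on which the one-step
transition probabilities do not depend on the starting point. -/
structure IsAccessibleAtom (P : Kernel X X) (π : Measure X) (A : Set X) : Prop where
  measurableSet : MeasurableSet A
  pos : 0 < π A
  atom : ∃ ν : Measure X, IsProbabilityMeasure ν ∧
    ∀ x ∈ A, ∀ B, MeasurableSet B → P x B = ν B

/-- `(f, P f)_{L²(π)} ≥ 0` for every real `f ∈ L²(π)`. -/
def IsNonnegDefinite (P : Kernel X X) (π : Measure X) : Prop :=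
  ∀ f : X → ℝ, MemLp f 2 π → 0 ≤ ∫ x, f x * (∫ y, f y ∂(P x)) ∂π

/-- `‖μ - ν‖_var = sup_{|f| ≤ 1} |μ(f) - ν(f)|` over measurable `f`, for finite measures
(so it lies in `[0, 2]` for probability measures). -/
noncomputable def varDist (μ ν : Measure X) : ℝ≥0∞ :=
  ⨆ (f : X → ℝ) (_ : Measurable f) (_ : ∀ x, |f x| ≤ 1),
    ENNReal.ofReal |(∫ x, f x ∂μ) - ∫ x, f x ∂ν|

section Operator

set_option linter.unusedSectionVars false

variable {𝕜 : Type*} [RCLike 𝕜] {P : Kernel X X} [IsMarkovKernel P] {π : Measure X}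

theorem ae_ae_of_invariant (h : P.Invariant π) {p : X → Prop} (hp : ∀ᵐ y ∂π, p y) :
    ∀ᵐ x ∂π, ∀ᵐ y ∂(P x), p y := by
  rw [← h.def] at hp
  exact Measure.ae_ae_of_ae_comp hp

theorem aestronglyMeasurable_apply (f : Lp 𝕜 2 π) :
    AEStronglyMeasurable (fun x => ∫ y, f y ∂(P x)) π :=
  ((Lp.stronglyMeasurable f).integral_kernel (κ := P)).aestronglyMeasurable

theorem eLpNorm_apply_le (h : P.Invariant π) (f : Lp 𝕜 2 π) :
    eLpNorm (fun x => ∫ y, f y ∂(P x)) 2 π ≤ eLpNorm f 2 π := by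
  have hsq : ∀ (μ : Measure X) (g : X → 𝕜),
      eLpNorm g 2 μ = (∫⁻ x, ‖g x‖ₑ ^ (2 : ℝ) ∂μ) ^ (1 / (2 : ℝ)) := by
    intro μ g
    simp [eLpNorm_eq_lintegral_rpow_enorm_toReal]
  rw [hsq, hsq]
  gcongr ?_ ^ _
  have hm : Measurable fun y => ‖f y‖ₑ ^ (2 : ℝ) :=
    (Lp.stronglyMeasurable f).measurable.enorm.pow_const _
  calc ∫⁻ x, ‖∫ y, f y ∂(P x)‖ₑ ^ (2 : ℝ) ∂π
      ≤ ∫⁻ x, ∫⁻ y, ‖f y‖ₑ ^ (2 : ℝ) ∂(P x) ∂π := by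
        gcongr with x
        have h1 : ‖∫ y, f y ∂(P x)‖ₑ ≤ eLpNorm f 2 (P x) :=
          calc ‖∫ y, f y ∂(P x)‖ₑ ≤ ∫⁻ y, ‖f y‖ₑ ∂(P x) := enorm_integral_le_lintegral_enorm _
            _ = eLpNorm f 1 (P x) := eLpNorm_one_eq_lintegral_enorm.symm
            _ ≤ eLpNorm f 2 (P x) := eLpNorm_le_eLpNorm_of_exponent_le one_le_two
                (Lp.stronglyMeasurable f).aestronglyMeasurable
        calc ‖∫ y, f y ∂(P x)‖ₑ ^ (2 : ℝ) ≤ (eLpNorm f 2 (P x)) ^ (2 : ℝ) := by gcongr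
          _ = _ := by
            rw [hsq, ← ENNReal.rpow_mul]
            norm_num
    _ = ∫⁻ y, ‖f y‖ₑ ^ (2 : ℝ) ∂(π.bind P) :=
        (Measure.lintegral_bind P.aemeasurable hm.aemeasurable).symm
    _ = ∫⁻ y, ‖f y‖ₑ ^ (2 : ℝ) ∂π := by rw [h.def]

theorem memLp_apply (h : P.Invariant π) (f : Lp 𝕜 2 π) :
    MemLp (fun x => ∫ y, f y ∂(P x)) 2 π :=
  ⟨aestronglyMeasurable_apply f, (eLpNorm_apply_le h f).trans_lt (Lp.memLp f).2⟩

theorem ae_integrable (h : P.Invariant π) [IsFiniteMeasure π] (f : Lp 𝕜 2 π) :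
    ∀ᵐ x ∂π, Integrable f (P x) := by
  have hi : Integrable f (π.bind P) := by
    rw [h.def]
    exact (Lp.memLp f).integrable one_le_two
  exact (Measure.integrable_comp_iff hi.1).1 hi |>.1

/-- The transition operator `(P f)(x) = ∫ f(y) P(x, dy)` on `L²(π)`, for `π` invariant. -/
noncomputable def L2Op [IsProbabilityMeasure π] (h : P.Invariant π) :
    Lp 𝕜 2 π →L[𝕜] Lp 𝕜 2 π :=
  LinearMap.mkContinuous
    { toFun := fun f => (memLp_apply h f).toLp _
      map_add' := by
        intro f g
        rw [← MemLp.toLp_add, MemLp.toLp_eq_toLp_iff]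
        filter_upwards [ae_ae_of_invariant h (Lp.coeFn_add f g), ae_integrable h f,
          ae_integrable h g] with x hx hf hg
        rw [integral_congr_ae hx]
        exact integral_add hf hg
      map_smul' := by
        intro c f
        rw [RingHom.id_apply, ← MemLp.toLp_const_smul, MemLp.toLp_eq_toLp_iff]
        filter_upwards [ae_ae_of_invariant h (Lp.coeFn_smul c f)] with x hx
        rw [integral_congr_ae hx]
        exact integral_smul c _ } 1
    (by
      intro f
      rw [one_mul]
      change ‖(memLp_apply h f).toLp _‖ ≤ ‖f‖
      rw [Lp.norm_toLp, Lp.norm_def]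
      exact ENNReal.toReal_mono (Lp.memLp f).2.ne (eLpNorm_apply_le h f))

theorem L2Op_ae [IsProbabilityMeasure π] (h : P.Invariant π) (f : Lp 𝕜 2 π) :
    L2Op h f =ᵐ[π] fun x => ∫ y, f y ∂(P x) :=
  (memLp_apply h f).coeFn_toLp

variable (𝕜 π) in
/-- The Hilbert space `{f ∈ L²(π) : π(f) = 0}`. -/
noncomputable def meanZero [IsProbabilityMeasure π] : Submodule 𝕜 (Lp 𝕜 2 π) where
  carrier := {f | ∫ x, f x ∂π = 0}
  zero_mem' := by
    change ∫ x, (0 : Lp 𝕜 2 π) x ∂π = 0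
    rw [integral_congr_ae (Lp.coeFn_zero 𝕜 2 π)]
    simp
  add_mem' := by
    intro f g (hf : _ = _) (hg : _ = _)
    change ∫ x, (f + g : Lp 𝕜 2 π) x ∂π = 0
    rw [integral_congr_ae (Lp.coeFn_add f g)]
    simp only [Pi.add_apply]
    rw [integral_add ((Lp.memLp f).integrable one_le_two) ((Lp.memLp g).integrable one_le_two),
      hf, hg, add_zero]
  smul_mem' := by
    intro c f (hf : _ = _)
    change ∫ x, (c • f : Lp 𝕜 2 π) x ∂π = 0
    rw [integral_congr_ae (Lp.coeFn_smul c f)]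
    simp only [Pi.smul_apply]
    rw [integral_smul, hf, smul_zero]

theorem L2Op_mem_meanZero [IsProbabilityMeasure π] (h : P.Invariant π) :
    ∀ f ∈ meanZero 𝕜 π, L2Op h f ∈ meanZero 𝕜 π := by
  intro f (hf : ∫ x, f x ∂π = 0)
  change ∫ x, L2Op h f x ∂π = 0
  rw [integral_congr_ae (L2Op_ae h f)]
  have hc : (P ∘ₖ Kernel.const Unit π) () = π := by
    rw [Kernel.comp_apply, Kernel.const_apply, h.def]
  have hi : Integrable f ((P ∘ₖ Kernel.const Unit π) ()) := by
    rw [hc]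
    exact (Lp.memLp f).integrable one_le_two
  have := Kernel.integral_comp hi
  rw [hc, hf, Kernel.const_apply] at this
  exact this.symm

variable (𝕜) in
/-- The restriction of the transition operator to `{f ∈ L²(π) : π(f) = 0}`. -/
noncomputable def meanZeroOp [IsProbabilityMeasure π] (h : P.Invariant π) :
    meanZero 𝕜 π →L[𝕜] meanZero 𝕜 π :=
  (L2Op h).restrict (L2Op_mem_meanZero h)

end Operator

variable (𝕜 : Type*) [RCLike 𝕜] in
/-- `r₀(P)`: the spectral radius of the transition operator on `{f ∈ L²(π; 𝕜) : π(f) = 0}`,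
for `π` invariant. -/
noncomputable def r₀ {P : Kernel X X} [IsMarkovKernel P] {π : Measure X} [IsProbabilityMeasure π]
    (h : P.Invariant π) : ℝ≥0∞ :=
  spectralRadius 𝕜 (meanZeroOp 𝕜 h)

end MarkovChain

/-! Let `Q f = P (1_{Aᶜ} f)` be the transition operator killed on `A`, so that `Qⁿ 1 (x) = P_x(τ_A >
n)`, and let `V = ∑ κⁿ Qⁿ 1`. The moment hypothesis bounds `V` on `A`. Invariance of `π` turns this
into `∫_{Aᶜ} Qᵐ 1 dπ ≤ C κ⁻ᵐ`. Reversibility makes `Q` self-adjoint on `L²(Aᶜ, π)`, so for bounded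
`f` the sequence `κ²ⁿ ‖Qⁿ f‖²` is log-convex; being bounded as well, it cannot increase at its first
step, which gives `κ ‖Q f‖ ≤ ‖f‖` with no loss in the constant
(`setLIntegral_sq_tabooOp_le_of_bounded`).

The atom carries this over to `P`. Since `P g` is constant on `A`, a function with zero integral
over `A` has the same quadratic form as its restriction to `Aᶜ`; a mean-zero function is brought to
this case by adding a constant (`inner_L2Op_le`). Non-negative definiteness turns the upper bound on
the form into `κ ‖P f‖ ≤ ‖f‖` on mean-zero functions (`mul_norm_L2Op_le`), which gives the spectral
radius.

As `Pⁿ f` is constant on `A` for `n ≥ 1`, pairing it with `1_A - π(A)` recovers its value there from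
the `L²` bound (`abs_integral_pow_sub_le`). From other starting points one conditions on the
entrance into `A`; the constant is then a multiple of `V`, which is finite almost everywhere by
irreducibility. -/

namespace MarkovChain

variable {X : Type*} [MeasurableSpace X]

/-! ### Markov property of the trajectory law. -/

section Law

variable (P : Kernel X X) [IsMarkovKernel P]

/-- The initial segments of the chain follow the finite-horizon kernels. -/
theorem law_map_frestrictLe (x : X) (c : ℕ) :
    (law P x).map (Preorder.frestrictLe c) =
      Kernel.partialTraj (X := fun _ => X)
        (fun n => P.comap (fun h : (Π _ : Finset.Iic n, X) => h ⟨n, Finset.mem_Iic.2 le_rfl⟩)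
          (measurable_pi_apply _)) 0 c (fun _ => x) := by
  rw [law, Kernel.traj_map_frestrictLe_apply]

/-- One step of the Markov property for the law of the chain. -/
theorem lintegral_law_mul_succ (x : X) (b : ℕ) {G : (Π _ : Finset.Iic b, X) → ℝ≥0∞}
    (hG : Measurable G) {g : X → ℝ≥0∞} (hg : Measurable g) :
    ∫⁻ ω, G (Preorder.frestrictLe b ω) * g (ω (b + 1)) ∂(law P x) =
      ∫⁻ ω, G (Preorder.frestrictLe b ω) * ∫⁻ y, g y ∂(P (ω b)) ∂(law P x) := by
  set κ : (n : ℕ) → Kernel (Π _ : Finset.Iic n, X) X := fun n =>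
    P.comap (fun h : (Π _ : Finset.Iic n, X) => h ⟨n, Finset.mem_Iic.2 le_rfl⟩)
      (measurable_pi_apply _) with hκ
  have hPg : Measurable fun x => ∫⁻ y, g y ∂(P x) := hg.lintegral_kernel
  let F₁ : (Π _ : Finset.Iic (b + 1), X) → ℝ≥0∞ := fun z =>
    G (Preorder.frestrictLe₂ (π := fun _ => X) b.le_succ z) *
      g (z ⟨b + 1, Finset.mem_Iic.2 le_rfl⟩)
  let F₂ : (Π _ : Finset.Iic b, X) → ℝ≥0∞ := fun z =>
    G z * ∫⁻ y, g y ∂(P (z ⟨b, Finset.mem_Iic.2 le_rfl⟩))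
  have hF₁ : Measurable F₁ := by
    refine (hG.comp (Preorder.measurable_frestrictLe₂ _)).mul (hg.comp (measurable_pi_apply _))
  have hF₂ : Measurable F₂ := hG.mul (hPg.comp (measurable_pi_apply _))
  have h1 : ∫⁻ ω, G (Preorder.frestrictLe b ω) * g (ω (b + 1)) ∂(law P x) =
      ∫⁻ z, F₁ z ∂(Kernel.partialTraj (X := fun _ => X) κ 0 (b + 1) (fun _ => x)) := by
    rw [← law_map_frestrictLe, lintegral_map hF₁ (Preorder.measurable_frestrictLe _)]
    rfl
  have h2 : ∫⁻ ω, G (Preorder.frestrictLe b ω) * ∫⁻ y, g y ∂(P (ω b)) ∂(law P x) =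
      ∫⁻ z, F₂ z ∂(Kernel.partialTraj (X := fun _ => X) κ 0 b (fun _ => x)) := by
    rw [← law_map_frestrictLe, lintegral_map hF₂ (Preorder.measurable_frestrictLe _)]
    rfl
  have hF₁M : Measurable fun a => F₁ (IicProdIoc (X := fun _ => X) b (b + 1) a) :=
    hF₁.comp measurable_IicProdIoc
  have hM : Measurable (IicProdIoc (X := fun _ => X) b (b + 1)) := measurable_IicProdIoc
  rw [h1, h2, Kernel.partialTraj_succ_of_le zero_le, Kernel.lintegral_map _ hM _ hF₁,
    Kernel.lintegral_comp _ _ _ hF₁M]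
  refine lintegral_congr fun z => ?_
  have : IsMarkovKernel ((κ b).map (MeasurableEquiv.piSingleton (X := fun _ => X) b)) :=
    Kernel.IsMarkovKernel.map _ (MeasurableEquiv.measurable _)
  have hF₁z : Measurable fun w => F₁ (IicProdIoc (X := fun _ => X) b (b + 1) (z, w)) :=
    hF₁M.comp measurable_prodMk_left
  rw [Kernel.lintegral_id_prod hF₁M, Kernel.lintegral_map _ (MeasurableEquiv.measurable _) _ hF₁z]
  change _ = G z * ∫⁻ y, g y ∂(P (z ⟨b, Finset.mem_Iic.2 le_rfl⟩))
  rw [← lintegral_const_mul _ hg]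
  refine lintegral_congr fun y => ?_
  have e1 : Preorder.frestrictLe₂ (π := fun _ => X) b.le_succ
      (IicProdIoc (X := fun _ => X) b (b + 1)
        (z, MeasurableEquiv.piSingleton (X := fun _ => X) b y)) = z :=
    congrFun (frestrictLe₂_comp_IicProdIoc (X := fun _ => X) b.le_succ)
      (z, MeasurableEquiv.piSingleton (X := fun _ => X) b y)
  have e2 : IicProdIoc (X := fun _ => X) b (b + 1)
      (z, MeasurableEquiv.piSingleton (X := fun _ => X) b y)
      ⟨b + 1, Finset.mem_Iic.2 le_rfl⟩ = y := by
    simp [IicProdIoc, MeasurableEquiv.piSingleton]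
  simp only [F₁, e1, e2]

theorem lintegral_law_zero (x : X) {g : X → ℝ≥0∞} (hg : Measurable g) :
    ∫⁻ ω, g (ω 0) ∂(law P x) = g x := by
  let F : (Π _ : Finset.Iic 0, X) → ℝ≥0∞ := fun z => g (z ⟨0, Finset.mem_Iic.2 le_rfl⟩)
  have hF : Measurable F := hg.comp (measurable_pi_apply _)
  have h := lintegral_map (μ := law P x) hF (Preorder.measurable_frestrictLe (X := fun _ => X) 0)
  rw [law_map_frestrictLe, Kernel.partialTraj_self, Kernel.id_apply, lintegral_dirac' _ hF] at h
  exact h.symm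

end Law

/-! ### The chain killed on `A` and the tail of the return time. -/

section Taboo

/-- The taboo transition operator `f ↦ ∫_{Aᶜ} f(y) P(x, dy)`. -/
noncomputable def tabooOp (P : Kernel X X) (A : Set X) (f : X → ℝ≥0∞) (x : X) : ℝ≥0∞ :=
  ∫⁻ y in Aᶜ, f y ∂(P x)

variable {P : Kernel X X} {A : Set X}

theorem tabooOp_eq_indicator (hA : MeasurableSet A) (f : X → ℝ≥0∞) (x : X) :
    tabooOp P A f x = ∫⁻ y, Aᶜ.indicator f y ∂(P x) :=
  (lintegral_indicator hA.compl f).symm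

theorem measurable_tabooOp (hA : MeasurableSet A) {f : X → ℝ≥0∞} (hf : Measurable f) :
    Measurable (tabooOp P A f) := by
  simp_rw [funext (tabooOp_eq_indicator (P := P) hA f)]
  exact (hf.indicator hA.compl).lintegral_kernel

theorem measurable_tabooOp_iterate (hA : MeasurableSet A) {f : X → ℝ≥0∞} (hf : Measurable f)
    (n : ℕ) : Measurable ((tabooOp P A)^[n] f) := by
  induction n with
  | zero => exact hf
  | succ n ih =>
    rw [Function.iterate_succ_apply']
    exact measurable_tabooOp hA ih

variable [IsMarkovKernel P]

/-- The trajectories that avoid `A` at the times `1, …, n`. -/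
def avoidSet (A : Set X) (n : ℕ) : Set (ℕ → X) := {ω | ∀ i, 1 ≤ i → i ≤ n → ω i ∉ A}

theorem measurableSet_avoidSet (hA : MeasurableSet A) (n : ℕ) :
    MeasurableSet (avoidSet A n) := by
  have : avoidSet A n = ⋂ i, ⋂ (_ : 1 ≤ i), ⋂ (_ : i ≤ n), (fun ω : ℕ → X => ω i) ⁻¹' Aᶜ := by
    ext ω
    simp [avoidSet]
  rw [this]
  exact .iInter fun i => .iInter fun _ => .iInter fun _ => measurable_pi_apply i hA.compl

/-- The Markov property at the last step replaces `g` by `tabooOp P A g`, so the induction needs `g`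
arbitrary; only `g = 1` is used afterwards. -/
theorem lintegral_law_avoidSet (hA : MeasurableSet A) (x : X) (n : ℕ) :
    ∀ {g : X → ℝ≥0∞}, Measurable g →
      ∫⁻ ω, (avoidSet A n).indicator 1 ω * g (ω n) ∂(law P x) = (tabooOp P A)^[n] g x := by
  induction n with
  | zero =>
    intro g hg
    have : avoidSet A 0 = Set.univ := by
      ext ω
      simp only [avoidSet, Set.mem_ofPred_eq, Set.mem_univ, iff_true]
      intro i h1 h2
      omega
    simpa [this] using lintegral_law_zero P x hg
  | succ n ih =>
    intro g hg
    let S : Set (Π _ : Finset.Iic n, X) := {z | ∀ i, 1 ≤ i.1 → z i ∉ A}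
    have hS : MeasurableSet S := by
      have : S = ⋂ i : Finset.Iic n, ⋂ (_ : 1 ≤ i.1),
          (fun z : (Π _ : Finset.Iic n, X) => z i) ⁻¹' Aᶜ := by
        ext z
        simp only [S, Set.mem_ofPred_eq, Set.mem_iInter, Set.mem_preimage, Set.mem_compl_iff]
      rw [this]
      exact .iInter fun i => .iInter fun _ => measurable_pi_apply i hA.compl
    have hres : ∀ ω : ℕ → X, (avoidSet A n).indicator (1 : (ℕ → X) → ℝ≥0∞) ω =
        S.indicator 1 (Preorder.frestrictLe n ω) := by
      intro ω
      have : ω ∈ avoidSet A n ↔ Preorder.frestrictLe n ω ∈ S := by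
        refine ⟨fun h i hi => h i hi (Finset.mem_Iic.1 i.2), fun h i hi hin => ?_⟩
        exact h ⟨i, Finset.mem_Iic.2 hin⟩ hi
      by_cases h : ω ∈ avoidSet A n
      · simp [h, this.1 h]
      · simp [h, mt this.2 h]
    have hstep : ∀ ω : ℕ → X, (avoidSet A (n + 1)).indicator (1 : (ℕ → X) → ℝ≥0∞) ω * g (ω (n + 1))
        = S.indicator 1 (Preorder.frestrictLe n ω) * Aᶜ.indicator g (ω (n + 1)) := by
      intro ω
      rw [← hres]
      have : ω ∈ avoidSet A (n + 1) ↔ ω ∈ avoidSet A n ∧ ω (n + 1) ∉ A := by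
        refine ⟨fun h => ⟨fun i h1 h2 => h i h1 (by omega), h _ (by omega) le_rfl⟩, ?_⟩
        rintro ⟨h, h'⟩ i h1 h2
        rcases Nat.lt_or_ge n i with hi | hi
        · obtain rfl : i = n + 1 := by omega
          exact h'
        · exact h i h1 hi
      by_cases h1 : ω ∈ avoidSet A n <;> by_cases h2 : ω (n + 1) ∈ A <;>
        simp [this, h1, h2]
    simp_rw [hstep]
    rw [lintegral_law_mul_succ P x n (measurable_one.indicator hS) (hg.indicator hA.compl),
      Function.iterate_succ_apply, ← ih (measurable_tabooOp hA hg)]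
    simp_rw [hres, tabooOp_eq_indicator hA]

theorem lt_returnTime_iff {Y : Type*} {A : Set Y} {ω : ℕ → Y} {n : ℕ} :
    (n : ℕ∞) < returnTime A ω ↔ ω ∈ avoidSet A n := by
  have h := hittingAfter_le_iff (u := fun n (ω : ℕ → Y) => ω n) (s := A) (n := 1) (i := n) (ω := ω)
  have h' : (n : ℕ∞) < returnTime A ω ↔ ¬ (returnTime A ω ≤ (n : ℕ∞)) := not_le.symm
  rw [h']
  refine (not_congr h).trans ?_
  simp only [avoidSet, Set.mem_ofPred_eq, Set.mem_Icc, not_exists, not_and]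
  exact ⟨fun h i h1 h2 => h i ⟨h1, h2⟩, fun h i hi => h i hi.1 hi.2⟩

theorem tabooOp_iterate_one (hA : MeasurableSet A) (x : X) (n : ℕ) :
    (tabooOp P A)^[n] 1 x = law P x (avoidSet A n) := by
  rw [← lintegral_law_avoidSet hA x n measurable_one]
  simp [lintegral_indicator_one (measurableSet_avoidSet hA n)]

/-- The generating series `∑ κⁿ P_x(τ_A > n)` of the tail of the return time. -/
noncomputable def tailSeries (P : Kernel X X) (A : Set X) (κ : ℝ) (x : X) : ℝ≥0∞ :=
  ∑' n : ℕ, ENNReal.ofReal κ ^ n * (tabooOp P A)^[n] 1 x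

/-- For finite `t` the left side is the geometric sum `κ ^ t - 1`. -/
theorem sub_one_mul_sum_le_geomPow {κ : ℝ} (hκ : 1 < κ) (t : ℕ∞) :
    ENNReal.ofReal (κ - 1) * ∑' n : ℕ, (if (n : ℕ∞) < t then ENNReal.ofReal κ ^ n else 0) ≤
      geomPow κ t := by
  cases t with
  | top => exact le_top
  | coe m =>
    change _ ≤ ENNReal.ofReal κ ^ m
    have : ∑' n : ℕ, (if (n : ℕ∞) < (m : ℕ∞) then ENNReal.ofReal κ ^ n else 0) =
        ENNReal.ofReal (∑ n ∈ Finset.range m, κ ^ n) := by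
      rw [tsum_eq_sum (s := Finset.range m), ENNReal.ofReal_sum_of_nonneg]
      · refine Finset.sum_congr rfl fun n hn => ?_
        rw [if_pos (by exact_mod_cast Finset.mem_range.1 hn), ENNReal.ofReal_pow (by linarith)]
      · intro n _
        positivity
      · intro n hn
        rw [if_neg]
        simpa using hn
    rw [this, ← ENNReal.ofReal_mul (by linarith), mul_geom_sum, ← ENNReal.ofReal_pow (by linarith)]
    exact ENNReal.ofReal_le_ofReal (by linarith)

theorem sub_one_mul_tailSeries_le (hA : MeasurableSet A) {κ : ℝ} (hκ : 1 < κ) (x : X) :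
    ENNReal.ofReal (κ - 1) * tailSeries P A κ x ≤ geomMoment P A κ x := by
  have hmeas : ∀ n : ℕ, Measurable fun ω : ℕ → X =>
      ENNReal.ofReal κ ^ n * (avoidSet A n).indicator 1 ω := fun n =>
    (measurable_one.indicator (measurableSet_avoidSet hA n)).const_mul _
  calc ENNReal.ofReal (κ - 1) * tailSeries P A κ x
      = ENNReal.ofReal (κ - 1) *
          ∫⁻ ω, ∑' n : ℕ, ENNReal.ofReal κ ^ n * (avoidSet A n).indicator 1 ω ∂(law P x) := by
        rw [lintegral_tsum fun n => (hmeas n).aemeasurable, tailSeries]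
        congr 2 with n
        rw [lintegral_const_mul _ (measurable_one.indicator (measurableSet_avoidSet hA n)),
          lintegral_indicator_one (measurableSet_avoidSet hA n), tabooOp_iterate_one hA]
    _ = ∫⁻ ω, ENNReal.ofReal (κ - 1) *
          ∑' n : ℕ, ENNReal.ofReal κ ^ n * (avoidSet A n).indicator 1 ω ∂(law P x) :=
        (lintegral_const_mul _ (.tsum hmeas)).symm
    _ ≤ geomMoment P A κ x := by
        refine lintegral_mono fun ω => le_trans (le_of_eq ?_)
          (sub_one_mul_sum_le_geomPow hκ (returnTime A ω))
        congr 2 with n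
        by_cases h : ω ∈ avoidSet A n
        · simp [h, lt_returnTime_iff.2 h]
        · simp [h, mt lt_returnTime_iff.1 h]

theorem iSup_tailSeries_lt_top (hA : MeasurableSet A) {κ : ℝ} (hκ : 1 < κ)
    (hL : (⨆ x ∈ A, geomMoment P A κ x) < ⊤) : (⨆ x ∈ A, tailSeries P A κ x) < ⊤ := by
  have h0 : ENNReal.ofReal (κ - 1) ≠ 0 := by simpa using hκ
  refine lt_of_le_of_lt (iSup₂_le fun x hx => ?_)
    (ENNReal.div_lt_top hL.ne h0)
  rw [ENNReal.le_div_iff_mul_le (.inl h0) (.inl ENNReal.ofReal_ne_top), mul_comm]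
  exact (sub_one_mul_tailSeries_le hA hκ x).trans (le_iSup₂ (f := fun x _ => geomMoment P A κ x) x hx)

end Taboo

/-! ### Detailed balance and symmetry of the killed operator. -/

section Reversible

variable {P : Kernel X X} [IsMarkovKernel P] {π : Measure X} [IsProbabilityMeasure π] {A : Set X}

/-- Detailed balance as invariance of `π(dx) P(x, dy)` under exchange of the coordinates. -/
theorem map_swap_compProd (hrev : P.IsReversible π) :
    (π ⊗ₘ P).map Prod.swap = π ⊗ₘ P := by
  have : IsFiniteMeasure ((π ⊗ₘ P).map Prod.swap) := inferInstance
  refine Measure.ext_prod fun {s t} hs ht => ?_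
  rw [Measure.map_apply measurable_swap (hs.prod ht), Set.preimage_swap_prod,
    Measure.compProd_apply_prod ht hs, Measure.compProd_apply_prod hs ht]
  exact hrev ht hs

theorem lintegral_mul_kernel_comm (hrev : P.IsReversible π) {f g : X → ℝ≥0∞}
    (hf : Measurable f) (hg : Measurable g) :
    ∫⁻ x, f x * ∫⁻ y, g y ∂(P x) ∂π = ∫⁻ x, g x * ∫⁻ y, f y ∂(P x) ∂π := by
  have key : ∀ {f g : X → ℝ≥0∞}, Measurable f → Measurable g →
      ∫⁻ x, f x * ∫⁻ y, g y ∂(P x) ∂π = ∫⁻ z, f z.1 * g z.2 ∂(π ⊗ₘ P) := by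
    intro f g hf hg
    rw [Measure.lintegral_compProd (by fun_prop)]
    exact lintegral_congr fun x => (lintegral_const_mul _ hg).symm
  rw [key hf hg, key hg hf, ← map_swap_compProd hrev, lintegral_map (by fun_prop) measurable_swap,
    map_swap_compProd hrev]
  exact lintegral_congr fun z => mul_comm _ _

/-- `tabooOp` restricts only the arrival point; restricting the outer integral to `Aᶜ` restricts the
departure point too and makes the form symmetric. -/
theorem setLIntegral_mul_tabooOp_comm (hrev : P.IsReversible π) (hA : MeasurableSet A)
    {f g : X → ℝ≥0∞} (hf : Measurable f) (hg : Measurable g) :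
    ∫⁻ x in Aᶜ, f x * tabooOp P A g x ∂π = ∫⁻ x in Aᶜ, tabooOp P A f x * g x ∂π := by
  have h := lintegral_mul_kernel_comm hrev (hf.indicator hA.compl) (hg.indicator hA.compl)
  simp_rw [← tabooOp_eq_indicator hA] at h
  rw [← lintegral_indicator hA.compl, ← lintegral_indicator hA.compl]
  convert h using 2 <;> ext x <;> by_cases hx : x ∈ A <;> simp [hx, mul_comm]

theorem setLIntegral_mul_tabooOp_iterate_comm (hrev : P.IsReversible π) (hA : MeasurableSet A)
    (n : ℕ) : ∀ {f g : X → ℝ≥0∞}, Measurable f → Measurable g →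
    ∫⁻ x in Aᶜ, f x * (tabooOp P A)^[n] g x ∂π = ∫⁻ x in Aᶜ, (tabooOp P A)^[n] f x * g x ∂π := by
  induction n with
  | zero => intro f g _ _; rfl
  | succ n ih =>
    intro f g hf hg
    rw [Function.iterate_succ_apply', setLIntegral_mul_tabooOp_comm hrev hA hf
      (measurable_tabooOp_iterate hA hg n), ih (measurable_tabooOp hA hf) hg,
      ← Function.iterate_succ_apply]

end Reversible

section Invariant

variable {P : Kernel X X} {π : Measure X} {A : Set X}

theorem lintegral_kernel_of_invariant (hinv : P.Invariant π) {f : X → ℝ≥0∞} (hf : Measurable f) :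
    ∫⁻ x, ∫⁻ y, f y ∂(P x) ∂π = ∫⁻ x, f x ∂π := by
  rw [← Measure.lintegral_bind P.aemeasurable hf.aemeasurable, hinv.def]

theorem lintegral_tabooOp (hinv : P.Invariant π) (hA : MeasurableSet A) {f : X → ℝ≥0∞}
    (hf : Measurable f) : ∫⁻ x, tabooOp P A f x ∂π = ∫⁻ x in Aᶜ, f x ∂π := by
  simp_rw [tabooOp_eq_indicator hA]
  rw [lintegral_kernel_of_invariant hinv (hf.indicator hA.compl), lintegral_indicator hA.compl]

end Invariant

section TabooMono

variable {P : Kernel X X} {A : Set X}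

theorem tabooOp_mono : Monotone (tabooOp P A) := fun _ _ h _ => lintegral_mono h

theorem tabooOp_iterate_const_mul (hA : MeasurableSet A) {f : X → ℝ≥0∞} (hf : Measurable f)
    (c : ℝ≥0∞) (n : ℕ) :
    (tabooOp P A)^[n] (fun x => c * f x) = fun x => c * (tabooOp P A)^[n] f x := by
  induction n with
  | zero => rfl
  | succ n ih =>
    rw [Function.iterate_succ_apply', ih, Function.iterate_succ_apply']
    ext x
    exact lintegral_const_mul _ (measurable_tabooOp_iterate hA hf n)

end TabooMono

/-! ### Finiteness of the tail series and decay under `π`. -/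

section TailSeries

variable {P : Kernel X X} {A : Set X} {κ : ℝ}

theorem measurable_tailSeries (hA : MeasurableSet A) : Measurable (tailSeries P A κ) :=
  .tsum fun n => (measurable_tabooOp_iterate hA measurable_one n).const_mul _

/-- Splitting off the term `n = 0`. This one-step equation drives both the absorption argument below
and the final entrance induction. -/
theorem tailSeries_eq (hA : MeasurableSet A) (x : X) :
    tailSeries P A κ x = 1 + ENNReal.ofReal κ * tabooOp P A (tailSeries P A κ) x := by
  have h1 : tabooOp P A (tailSeries P A κ) x =
      ∑' n : ℕ, ENNReal.ofReal κ ^ n * (tabooOp P A)^[n + 1] 1 x := by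
    simp only [tabooOp, tailSeries]
    rw [lintegral_tsum fun n =>
      ((measurable_tabooOp_iterate hA measurable_one n).const_mul _).aemeasurable]
    refine tsum_congr fun n => ?_
    rw [lintegral_const_mul _ (measurable_tabooOp_iterate hA measurable_one n),
      Function.iterate_succ_apply']
    rfl
  rw [h1, ← ENNReal.tsum_mul_left, tailSeries, tsum_eq_zero_add' ENNReal.summable]
  congr 1
  · simp
  · exact tsum_congr fun n => by ring

/-- An absorbing set is absorbing for the iterated kernel. -/
theorem pow_apply_compl_eq_zero {S : Set X} (hS : MeasurableSet S) (h : ∀ x ∈ S, P x Sᶜ = 0)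
    (n : ℕ) {x : X} (hx : x ∈ S) : (P ^ n) x Sᶜ = 0 := by
  induction n with
  | zero =>
    change (Kernel.id : Kernel X X) x Sᶜ = 0
    rw [Kernel.id_apply, Measure.dirac_apply' _ hS.compl]
    simp [hx]
  | succ n ih =>
    rw [Kernel.pow_succ_apply_eq_lintegral _ _ _ hS.compl]
    refine (lintegral_congr_ae ?_).trans lintegral_zero
    have : ∀ᵐ b ∂((P ^ n) x), b ∈ S := ih
    filter_upwards [this] with b hb using h b hb

/-- By `tailSeries_eq`, if the series is finite at `x` then it is finite at `P x`-almost every point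
of `Aᶜ`, and it is finite on `A` by hypothesis. So its finiteness set is absorbing and contains `A`;
irreducibility forbids a complement of positive measure. -/
theorem ae_tailSeries_lt_top {π : Measure X} [hirr : Kernel.IsIrreducible π P]
    (hA : MeasurableSet A) (hne : A.Nonempty) (hκ : 0 < κ)
    (hV : (⨆ x ∈ A, tailSeries P A κ x) < ⊤) : ∀ᵐ x ∂π, tailSeries P A κ x < ⊤ := by
  set S : Set X := {x | tailSeries P A κ x < ⊤} with hSdef
  have hS : MeasurableSet S := measurableSet_lt (measurable_tailSeries hA) measurable_const
  have hAS : A ⊆ S := fun x hx =>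
    (le_iSup₂ (f := fun x _ => tailSeries P A κ x) x hx).trans_lt hV
  have habs : ∀ x ∈ S, P x Sᶜ = 0 := by
    intro x hx
    have h1 : tabooOp P A (tailSeries P A κ) x ≠ ⊤ := by
      intro h
      have hx' : tailSeries P A κ x < ⊤ := hx
      rw [tailSeries_eq hA, h, ENNReal.mul_top (by simpa using hκ)] at hx'
      simp at hx'
    have h2 := ae_lt_top (measurable_tailSeries hA) h1
    rw [ae_restrict_iff' hA.compl] at h2
    refine measure_mono_null ?_ (ae_iff.1 h2)
    intro y hy
    simp only [Set.mem_ofPred_eq, Classical.not_imp]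
    exact ⟨fun hyA => hy (hAS hyA), hy⟩
  obtain ⟨a, ha⟩ := hne
  by_contra hcon
  have hpos : 0 < π Sᶜ := pos_iff_ne_zero.2 fun h => hcon h
  obtain ⟨n, hn⟩ := hirr.irreducible hS.compl hpos a
  exact hn.ne' (pow_apply_compl_eq_zero hS habs n (hAS ha))

variable [IsMarkovKernel P]

theorem tabooOp_iterate_one_le_one (hA : MeasurableSet A) (n : ℕ) (x : X) :
    (tabooOp P A)^[n] 1 x ≤ 1 := by
  rw [tabooOp_iterate_one hA]
  have : IsProbabilityMeasure (law P x) := by unfold law; infer_instance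
  exact prob_le_one

/-- Under `π`, the probability of avoiding `A` until time `m` decays geometrically. -/
theorem pow_mul_setLIntegral_tabooOp_iterate_one_le {π : Measure X} [IsProbabilityMeasure π]
    (hinv : P.Invariant π) (hA : MeasurableSet A) (hκ : 1 < κ)
    (hV : ∀ᵐ x ∂π, tailSeries P A κ x < ⊤) (m : ℕ) :
    ENNReal.ofReal κ ^ m * ∫⁻ x in Aᶜ, (tabooOp P A)^[m] 1 x ∂π ≤
      ⨆ x ∈ A, tailSeries P A κ x := by
  set s : ℕ → X → ℝ≥0∞ := fun n => (tabooOp P A)^[n] 1 with hs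
  have hsm : ∀ n, Measurable (s n) := measurable_tabooOp_iterate hA measurable_one
  have hk1 : 1 ≤ ENNReal.ofReal κ := by simpa using hκ.le
  -- Invariance gives `∫_{Aᶜ} s n dπ = ∫ s (n + 1) dπ`; iterating expresses the integral over `Aᶜ`
  -- through integrals over `A`, where the series is bounded.
  have hstep : ∀ n, ∫⁻ x in Aᶜ, s n x ∂π =
      ∫⁻ x in Aᶜ, s (n + 1) x ∂π + ∫⁻ x in A, s (n + 1) x ∂π := by
    intro n
    rw [add_comm, lintegral_add_compl _ hA, ← lintegral_tabooOp hinv hA (hsm n)]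
    simp only [hs, Function.iterate_succ_apply']
  have hsum : ∀ N, ∫⁻ x in Aᶜ, s m x ∂π = ∫⁻ x in Aᶜ, s (m + N) x ∂π +
      ∑ j ∈ Finset.range N, ∫⁻ x in A, s (m + j + 1) x ∂π := by
    intro N
    induction N with
    | zero => simp
    | succ N ih => rw [ih, hstep (m + N), Finset.sum_range_succ]; ring_nf
  -- The remainder vanishes by dominated convergence: where the series converges its terms `κⁿ s n
  -- x`, hence also `s n x`, tend to zero.
  have hlim : Filter.Tendsto (fun N => ∫⁻ x in Aᶜ, s (m + N) x ∂π) Filter.atTop (nhds 0) := by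
    have : Filter.Tendsto (fun N => ∫⁻ x in Aᶜ, s N x ∂π) Filter.atTop
        (nhds (∫⁻ _ in Aᶜ, (0 : ℝ≥0∞) ∂π)) := by
      refine tendsto_lintegral_of_dominated_convergence (fun _ => 1) hsm
        (fun n => .of_forall fun x => tabooOp_iterate_one_le_one hA n x) (by simp) ?_
      filter_upwards [ae_restrict_of_ae hV] with x hx
      refine tendsto_of_tendsto_of_tendsto_of_le_of_le tendsto_const_nhds
        (ENNReal.tendsto_atTop_zero_of_tsum_ne_top hx.ne) (fun _ => zero_le) fun n => ?_
      exact le_mul_of_one_le_left zero_le (one_le_pow₀ hk1)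
    rw [lintegral_zero] at this
    exact this.comp (Filter.tendsto_atTop_mono (fun N => Nat.le_add_left N m) Filter.tendsto_id)
  have hbound : ∀ N, ENNReal.ofReal κ ^ m * ∑ j ∈ Finset.range N, ∫⁻ x in A, s (m + j + 1) x ∂π ≤
      ⨆ x ∈ A, tailSeries P A κ x := by
    intro N
    rw [← lintegral_finsetSum _ fun j _ => hsm _, ← lintegral_const_mul _
      (Finset.measurable_fun_sum _ fun j _ => hsm _)]
    calc ∫⁻ x in A, ENNReal.ofReal κ ^ m * ∑ j ∈ Finset.range N, s (m + j + 1) x ∂π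
        ≤ ∫⁻ x in A, ⨆ x ∈ A, tailSeries P A κ x ∂π := by
          refine setLIntegral_mono' hA fun x hx => ?_
          refine le_trans ?_ (le_iSup₂ (f := fun x _ => tailSeries P A κ x) x hx)
          rw [Finset.mul_sum]
          calc ∑ j ∈ Finset.range N, ENNReal.ofReal κ ^ m * s (m + j + 1) x
              ≤ ∑ j ∈ Finset.range N, ENNReal.ofReal κ ^ (m + j + 1) * s (m + j + 1) x := by
                gcongr
                omega
            _ = ∑ j ∈ (Finset.range N).map (addRightEmbedding (m + 1)),
                  ENNReal.ofReal κ ^ j * s j x := by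
                rw [Finset.sum_map]
                refine Finset.sum_congr rfl fun j _ => ?_
                rw [addRightEmbedding_apply, show j + (m + 1) = m + j + 1 by ring]
            _ ≤ tailSeries P A κ x := ENNReal.sum_le_tsum _
      _ ≤ ⨆ x ∈ A, tailSeries P A κ x := by
          rw [lintegral_const, Measure.restrict_apply_univ]
          exact mul_le_of_le_one_right zero_le prob_le_one
  have hle : ∀ N, ENNReal.ofReal κ ^ m * ∫⁻ x in Aᶜ, s m x ∂π ≤
      ENNReal.ofReal κ ^ m * ∫⁻ x in Aᶜ, s (m + N) x ∂π + ⨆ x ∈ A, tailSeries P A κ x := by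
    intro N
    rw [hsum N, mul_add]
    gcongr
    exact hbound N
  have hlim' : Filter.Tendsto (fun N => ENNReal.ofReal κ ^ m * ∫⁻ x in Aᶜ, s (m + N) x ∂π +
      ⨆ x ∈ A, tailSeries P A κ x) Filter.atTop
      (nhds (ENNReal.ofReal κ ^ m * 0 + ⨆ x ∈ A, tailSeries P A κ x)) :=
    (ENNReal.Tendsto.const_mul hlim (.inr (ENNReal.pow_ne_top ENNReal.ofReal_ne_top))).add_const _
  rw [mul_zero, zero_add] at hlim'
  exact ge_of_tendsto' hlim' hle

end TailSeries

/-! ### The norm of the killed operator on `L²(Aᶜ)`. -/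

section QuadraticForm

/-- A bounded log-convex sequence does not increase at its first step. -/
theorem le_zero_of_logConvex_of_bounded {b : ℕ → ℝ} (h0 : ∀ n, 0 ≤ b n)
    (hlog : ∀ n, b (n + 1) ^ 2 ≤ b n * b (n + 2)) {C : ℝ} (hC : ∀ n, b n ≤ C) : b 1 ≤ b 0 := by
  by_contra! hlt
  -- By the arithmetic–geometric mean inequality log-convexity implies convexity, so an initial
  -- increase would persist and force linear growth.
  have hconv : ∀ n, b 1 - b 0 ≤ b (n + 1) - b n := by
    intro n
    induction n with
    | zero => exact le_rfl
    | succ n ih =>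
      have : 2 * b (n + 1) ≤ b n + b (n + 2) := by
        refine le_of_sq_le_sq ?_ (add_nonneg (h0 _) (h0 _))
        nlinarith [hlog n, sq_nonneg (b n - b (n + 2))]
      linarith
  have hlin : ∀ n : ℕ, b 0 + n * (b 1 - b 0) ≤ b n := by
    intro n
    induction n with
    | zero => simp
    | succ n ih =>
      push_cast
      linarith [hconv n]
  obtain ⟨n, hn⟩ := exists_nat_gt ((C - b 0) / (b 1 - b 0))
  rw [div_lt_iff₀ (by linarith)] at hn
  linarith [hlin n, hC n]

theorem sq_lintegral_mul_le {μ : Measure X} {f g : X → ℝ≥0∞} (hf : Measurable f)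
    (hg : Measurable g) :
    (∫⁻ x, f x * g x ∂μ) ^ 2 ≤ (∫⁻ x, f x ^ 2 ∂μ) * ∫⁻ x, g x ^ 2 ∂μ := by
  have h := ENNReal.lintegral_mul_le_Lp_mul_Lq μ Real.HolderConjugate.two_two hf.aemeasurable
    hg.aemeasurable
  have hsq : ∀ a : ℝ≥0∞, (a ^ (1 / (2 : ℝ))) ^ 2 = a := fun a => by
    rw [← ENNReal.rpow_natCast, ← ENNReal.rpow_mul]
    norm_num
  calc (∫⁻ x, f x * g x ∂μ) ^ 2
      ≤ ((∫⁻ x, f x ^ (2 : ℝ) ∂μ) ^ (1 / (2 : ℝ)) * (∫⁻ x, g x ^ (2 : ℝ) ∂μ) ^ (1 / (2 : ℝ))) ^ 2 := by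
        gcongr
        exact h
    _ = _ := by
        rw [mul_pow, hsq, hsq]
        simp only [ENNReal.rpow_two]

variable {P : Kernel X X} [IsMarkovKernel P] {π : Measure X} [IsProbabilityMeasure π] {A : Set X}
  {κ : ℝ}

/-- Positivity reduces `f` to the constant `N`, and symmetry gives `∫_{Aᶜ} (Qⁿ 1)² = ∫_{Aᶜ} Q²ⁿ 1`,
whose decay at rate `κ⁻²ⁿ` is known. -/
theorem setLIntegral_sq_tabooOp_iterate_le (hrev : P.IsReversible π) (hA : MeasurableSet A)
    (hκ : 1 < κ) (hV : ∀ᵐ x ∂π, tailSeries P A κ x < ⊤) {f : X → ℝ≥0∞} {N : ℝ≥0∞}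
    (hfN : ∀ x, f x ≤ N) (n : ℕ) :
    (ENNReal.ofReal κ ^ 2) ^ n * ∫⁻ x in Aᶜ, ((tabooOp P A)^[n] f x) ^ 2 ∂π ≤
      N ^ 2 * ⨆ x ∈ A, tailSeries P A κ x := by
  have h1m := measurable_tabooOp_iterate (P := P) hA (measurable_one (α := ℝ≥0∞) (β := X))
  have hle : ∀ x, (tabooOp P A)^[n] f x ≤ N * (tabooOp P A)^[n] 1 x := by
    have := (tabooOp_mono (P := P) (A := A)).iterate n
      (show f ≤ fun x => N * (1 : X → ℝ≥0∞) x by intro x; simpa using hfN x)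
    rw [tabooOp_iterate_const_mul hA measurable_one] at this
    exact this
  have hself : ∫⁻ x in Aᶜ, ((tabooOp P A)^[n] 1 x) ^ 2 ∂π =
      ∫⁻ x in Aᶜ, (tabooOp P A)^[2 * n] 1 x ∂π := by
    rw [two_mul, Function.iterate_add]
    have := setLIntegral_mul_tabooOp_iterate_comm hrev hA n
      (measurable_one (α := ℝ≥0∞) (β := X)) (h1m n)
    simp only [Pi.one_apply, one_mul] at this
    simp only [Function.comp_apply, sq, this]
  calc (ENNReal.ofReal κ ^ 2) ^ n * ∫⁻ x in Aᶜ, ((tabooOp P A)^[n] f x) ^ 2 ∂π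
      ≤ (ENNReal.ofReal κ ^ 2) ^ n * ∫⁻ x in Aᶜ, N ^ 2 * ((tabooOp P A)^[n] 1 x) ^ 2 ∂π := by
        gcongr with x
        rw [← mul_pow]
        gcongr
        exact hle x
    _ = N ^ 2 * (ENNReal.ofReal κ ^ (2 * n) * ∫⁻ x in Aᶜ, (tabooOp P A)^[2 * n] 1 x ∂π) := by
        rw [lintegral_const_mul _ ((h1m n).pow_const 2), hself]
        ring
    _ ≤ N ^ 2 * ⨆ x ∈ A, tailSeries P A κ x := by
        gcongr
        exact pow_mul_setLIntegral_tabooOp_iterate_one_le hrev.invariant hA hκ hV _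

theorem setLIntegral_sq_tabooOp_le_of_bounded (hrev : P.IsReversible π) (hA : MeasurableSet A)
    (hκ : 1 < κ) (hV : ∀ᵐ x ∂π, tailSeries P A κ x < ⊤)
    (hVA : (⨆ x ∈ A, tailSeries P A κ x) < ⊤) {f : X → ℝ≥0∞} (hf : Measurable f) {N : ℝ≥0∞}
    (hN : N ≠ ⊤) (hfN : ∀ x, f x ≤ N) :
    ENNReal.ofReal κ ^ 2 * ∫⁻ x in Aᶜ, (tabooOp P A f x) ^ 2 ∂π ≤ ∫⁻ x in Aᶜ, f x ^ 2 ∂π := by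
  set b : ℕ → ℝ≥0∞ := fun n =>
    (ENNReal.ofReal κ ^ 2) ^ n * ∫⁻ x in Aᶜ, ((tabooOp P A)^[n] f x) ^ 2 ∂π with hb
  set C : ℝ≥0∞ := N ^ 2 * ⨆ x ∈ A, tailSeries P A κ x with hC
  have hCtop : C ≠ ⊤ := ENNReal.mul_ne_top (ENNReal.pow_ne_top hN) hVA.ne
  have hbC : ∀ n, b n ≤ C := fun n => setLIntegral_sq_tabooOp_iterate_le hrev hA hκ hV hfN n
  have hbtop : ∀ n, b n ≠ ⊤ := fun n => ((hbC n).trans_lt hCtop.lt_top).ne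
  have hm := measurable_tabooOp_iterate (P := P) hA hf
  -- Symmetry gives `‖Qⁿ⁺¹ f‖² = ⟨Qⁿ f, Qⁿ⁺² f⟩`, and Cauchy–Schwarz applies.
  have hlog : ∀ n, b (n + 1) ^ 2 ≤ b n * b (n + 2) := by
    intro n
    have h1 : ∫⁻ x in Aᶜ, ((tabooOp P A)^[n + 1] f x) ^ 2 ∂π =
        ∫⁻ x in Aᶜ, (tabooOp P A)^[n] f x * (tabooOp P A)^[n + 2] f x ∂π := by
      have := setLIntegral_mul_tabooOp_comm hrev hA (hm n) (hm (n + 1))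
      simp only [← Function.iterate_succ_apply' (tabooOp P A)] at this
      simp only [sq]
      exact this.symm
    have h2 := sq_lintegral_mul_le (μ := π.restrict Aᶜ) (hm n) (hm (n + 2))
    rw [← h1] at h2
    calc b (n + 1) ^ 2 = (ENNReal.ofReal κ ^ 2) ^ (2 * n + 2) *
          (∫⁻ x in Aᶜ, ((tabooOp P A)^[n + 1] f x) ^ 2 ∂π) ^ 2 := by
          simp only [hb]; ring
      _ ≤ (ENNReal.ofReal κ ^ 2) ^ (2 * n + 2) * ((∫⁻ x in Aᶜ, ((tabooOp P A)^[n] f x) ^ 2 ∂π) *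
          ∫⁻ x in Aᶜ, ((tabooOp P A)^[n + 2] f x) ^ 2 ∂π) := by gcongr
      _ = b n * b (n + 2) := by simp only [hb]; ring
  have hreal := le_zero_of_logConvex_of_bounded (b := fun n => (b n).toReal)
    (fun _ => ENNReal.toReal_nonneg)
    (fun n => by
      rw [← ENNReal.toReal_pow, ← ENNReal.toReal_mul]
      exact ENNReal.toReal_mono (ENNReal.mul_ne_top (hbtop _) (hbtop _)) (hlog n))
    (C := C.toReal) (fun n => ENNReal.toReal_mono hCtop (hbC n))
  have := (ENNReal.toReal_le_toReal (hbtop 1) (hbtop 0)).1 hreal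
  simpa [hb] using this

theorem setLIntegral_mul_tabooOp_le_of_bounded (hrev : P.IsReversible π) (hA : MeasurableSet A)
    (hκ : 1 < κ) (hV : ∀ᵐ x ∂π, tailSeries P A κ x < ⊤)
    (hVA : (⨆ x ∈ A, tailSeries P A κ x) < ⊤) {f : X → ℝ≥0∞} (hf : Measurable f) {N : ℝ≥0∞}
    (hN : N ≠ ⊤) (hfN : ∀ x, f x ≤ N) :
    ENNReal.ofReal κ * ∫⁻ x in Aᶜ, f x * tabooOp P A f x ∂π ≤ ∫⁻ x in Aᶜ, f x ^ 2 ∂π := by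
  rw [← ENNReal.pow_le_pow_left_iff two_ne_zero, mul_pow]
  calc ENNReal.ofReal κ ^ 2 * (∫⁻ x in Aᶜ, f x * tabooOp P A f x ∂π) ^ 2
      ≤ ENNReal.ofReal κ ^ 2 *
        ((∫⁻ x in Aᶜ, f x ^ 2 ∂π) * ∫⁻ x in Aᶜ, (tabooOp P A f x) ^ 2 ∂π) := by
        gcongr
        exact sq_lintegral_mul_le hf (measurable_tabooOp hA hf)
    _ = (∫⁻ x in Aᶜ, f x ^ 2 ∂π) *
        (ENNReal.ofReal κ ^ 2 * ∫⁻ x in Aᶜ, (tabooOp P A f x) ^ 2 ∂π) := by ring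
    _ ≤ (∫⁻ x in Aᶜ, f x ^ 2 ∂π) * ∫⁻ x in Aᶜ, f x ^ 2 ∂π := by
        gcongr
        exact setLIntegral_sq_tabooOp_le_of_bounded hrev hA hκ hV hVA hf hN hfN
    _ = _ := (sq _).symm

/-- The compression of the transition operator to `L²(Aᶜ)` has norm at most `κ⁻¹`, in the form of
a bound on the quadratic form. -/
theorem setLIntegral_mul_tabooOp_le (hrev : P.IsReversible π) (hA : MeasurableSet A)
    (hκ : 1 < κ) (hV : ∀ᵐ x ∂π, tailSeries P A κ x < ⊤)
    (hVA : (⨆ x ∈ A, tailSeries P A κ x) < ⊤) {f : X → ℝ≥0∞} (hf : Measurable f) :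
    ENNReal.ofReal κ * ∫⁻ x in Aᶜ, f x * tabooOp P A f x ∂π ≤ ∫⁻ x in Aᶜ, f x ^ 2 ∂π := by
  -- Boundedness is removed by truncation and monotone convergence.
  set t : ℕ → X → ℝ≥0∞ := fun N x => min (f x) N with ht
  have htm : ∀ N, Measurable (t N) := fun N => hf.min measurable_const
  have htmono : Monotone t := fun M N h x => min_le_min le_rfl (by exact_mod_cast h)
  have htsup : ∀ x, ⨆ N, t N x = f x := fun x => by
    simp only [ht]
    rw [← inf_iSup_eq, ENNReal.iSup_natCast, inf_top_eq]
  have hQsup : ∀ x, ⨆ N, tabooOp P A (t N) x = tabooOp P A f x := fun x => by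
    simp only [tabooOp]
    rw [← lintegral_iSup htm htmono]
    simp only [htsup]
  have hprod : ∀ x, ⨆ N, t N x * tabooOp P A (t N) x = f x * tabooOp P A f x := fun x => by
    refine le_antisymm (iSup_le fun N => mul_le_mul' (htsup x ▸ le_iSup (fun N => t N x) N)
      (hQsup x ▸ le_iSup (fun N => tabooOp P A (t N) x) N)) ?_
    rw [← htsup x, ← hQsup x, ENNReal.iSup_mul]
    refine iSup_le fun M => ?_
    rw [ENNReal.mul_iSup]
    refine iSup_le fun N => ?_
    refine le_trans ?_ (le_iSup (fun N => t N x * tabooOp P A (t N) x) (max M N))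
    exact mul_le_mul' (htmono (le_max_left _ _) x) (tabooOp_mono (htmono (le_max_right _ _)) x)
  simp_rw [← hprod]
  rw [lintegral_iSup (f := fun N x => t N x * tabooOp P A (t N) x)
    (fun N => (htm N).mul (measurable_tabooOp hA (htm N)))
    (fun M N h x => mul_le_mul' (htmono h x) (tabooOp_mono (htmono h) x)), ENNReal.mul_iSup]
  refine iSup_le fun N => ?_
  refine (setLIntegral_mul_tabooOp_le_of_bounded hrev hA hκ hV hVA (htm N)
    (ENNReal.natCast_ne_top N) (fun x => min_le_right _ _)).trans ?_
  gcongr with x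
  exact min_le_left _ _

end QuadraticForm

theorem spectralRadius_le_of_norm_le {𝕜 E : Type*} [RCLike 𝕜] [NormedAddCommGroup E]
    [NormedSpace 𝕜 E] [CompleteSpace E] {T : E →L[𝕜] E} {c : ℝ} (hT : ‖T‖ ≤ c) :
    spectralRadius 𝕜 T ≤ ENNReal.ofReal c := by
  refine iSup₂_le fun k hk => ?_
  rw [← enorm_eq_nnnorm, ← ofReal_norm]
  refine ENNReal.ofReal_le_ofReal ?_
  -- The factor `‖1‖` stays because `E` may be trivial, where the identity has norm `0`.
  calc ‖k‖ ≤ ‖T‖ * ‖(1 : E →L[𝕜] E)‖ := spectrum.norm_le_norm_mul_of_mem hk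
    _ ≤ ‖T‖ * 1 := by
        gcongr
        exact ContinuousLinearMap.norm_id_le
    _ ≤ c := by rwa [mul_one]

section Inner

variable {π : Measure X}

theorem real_inner_eq_integral (f g : Lp ℝ 2 π) : inner ℝ f g = ∫ x, f x * g x ∂π := by
  rw [L2.inner_def]
  exact integral_congr_ae (.of_forall fun x => by simp [mul_comm])

theorem norm_sq_eq_integral {𝕜 : Type*} [RCLike 𝕜] (f : Lp 𝕜 2 π) :
    ‖f‖ ^ 2 = ∫ x, ‖f x‖ ^ 2 ∂π := by
  have h : (inner 𝕜 f f : 𝕜) = ((∫ x, ‖f x‖ ^ 2 ∂π : ℝ) : 𝕜) := by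
    rw [L2.inner_def, ← integral_ofReal]
    exact integral_congr_ae (.of_forall fun x => by simp [inner_self_eq_norm_sq_to_K])
  rw [inner_self_eq_norm_sq_to_K] at h
  exact_mod_cast h

theorem integrable_norm_sq {𝕜 : Type*} [RCLike 𝕜] (f : Lp 𝕜 2 π) :
    Integrable (fun x => ‖f x‖ ^ 2) π :=
  (memLp_two_iff_integrable_sq_norm (Lp.aestronglyMeasurable f)).1 (Lp.memLp f)

theorem norm_sq_eq_re_add_im {𝕜 : Type*} [RCLike 𝕜] (f : Lp 𝕜 2 π) {u v : Lp ℝ 2 π}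
    (hu : u =ᵐ[π] fun x => RCLike.re (f x)) (hv : v =ᵐ[π] fun x => RCLike.im (f x)) :
    ‖f‖ ^ 2 = ‖u‖ ^ 2 + ‖v‖ ^ 2 := by
  rw [norm_sq_eq_integral, norm_sq_eq_integral, norm_sq_eq_integral,
    ← integral_add (integrable_norm_sq u) (integrable_norm_sq v)]
  refine integral_congr_ae ?_
  filter_upwards [hu, hv] with x h1 h2
  rw [h1, h2, RCLike.norm_sq_eq_def, Real.norm_eq_abs, Real.norm_eq_abs, sq_abs, sq_abs]
  ring

end Inner

/-! ### From the killed operator to the contraction of `P` on mean-zero functions. -/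

section L2

variable {P : Kernel X X} [IsMarkovKernel P] {π : Measure X} [IsProbabilityMeasure π] {A : Set X}
  {κ : ℝ}

/-- Over the joint law of one step, self-adjointness becomes invariance under swapping coordinates.
-/
theorem integral_mul_L2Op (hinv : P.Invariant π) (f g : Lp ℝ 2 π) :
    ∫ x, f x * L2Op hinv g x ∂π = ∫ z, f z.1 * g z.2 ∂(π ⊗ₘ P) := by
  have h1 : MemLp (fun z : X × X => f z.1) 2 (π ⊗ₘ P) := by
    have : MemLp f 2 ((π ⊗ₘ P).map Prod.fst) := by
      rw [← Measure.fst, Measure.fst_compProd]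
      exact Lp.memLp f
    exact this.comp_of_map measurable_fst.aemeasurable
  have h2 : MemLp (fun z : X × X => g z.2) 2 (π ⊗ₘ P) := by
    have : MemLp g 2 ((π ⊗ₘ P).map Prod.snd) := by
      rw [← Measure.snd, Measure.snd_compProd, hinv.def]
      exact Lp.memLp g
    exact this.comp_of_map measurable_snd.aemeasurable
  have hint : Integrable (fun z : X × X => f z.1 * g z.2) (π ⊗ₘ P) := h1.integrable_mul h2
  rw [Measure.integral_compProd hint]
  refine integral_congr_ae ?_
  filter_upwards [L2Op_ae hinv g] with x hx
  rw [hx]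
  exact (integral_const_mul _ _).symm

theorem inner_L2Op_comm (hrev : P.IsReversible π) (f g : Lp ℝ 2 π) :
    inner ℝ f (L2Op hrev.invariant g) = inner ℝ (L2Op hrev.invariant f) g := by
  rw [← real_inner_comm, real_inner_comm g, real_inner_comm, real_inner_eq_integral,
    real_inner_eq_integral, integral_mul_L2Op, integral_mul_L2Op]
  conv_lhs => rw [← map_swap_compProd hrev]
  have hemb : MeasurableEmbedding (Prod.swap : X × X → X × X) :=
    (MeasurableEquiv.prodComm (α := X) (β := X)).measurableEmbedding
  rw [hemb.integral_map]
  exact integral_congr_ae (.of_forall fun z => mul_comm _ _)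

theorem inner_L2Op_nonneg (hinv : P.Invariant π) (hnonneg : IsNonnegDefinite P π)
    (f : Lp ℝ 2 π) : 0 ≤ inner ℝ f (L2Op hinv f) := by
  rw [real_inner_eq_integral]
  refine (hnonneg f (Lp.memLp f)).trans_eq (integral_congr_ae ?_)
  filter_upwards [L2Op_ae hinv f] with x hx
  rw [hx]

/-- The constant function `1` as an element of `L²(π)`. -/
noncomputable def oneLp (π : Measure X) [IsProbabilityMeasure π] : Lp ℝ 2 π :=
  (memLp_const (1 : ℝ)).toLp _

theorem oneLp_ae : oneLp π =ᵐ[π] fun _ => (1 : ℝ) := MemLp.coeFn_toLp _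

theorem inner_oneLp (f : Lp ℝ 2 π) : inner ℝ (oneLp π) f = ∫ x, f x ∂π := by
  rw [real_inner_eq_integral]
  refine integral_congr_ae ?_
  filter_upwards [oneLp_ae (π := π)] with x hx
  rw [hx, one_mul]

theorem L2Op_oneLp (hinv : P.Invariant π) : L2Op hinv (oneLp π) = oneLp π := by
  refine Lp.ext ?_
  filter_upwards [L2Op_ae hinv (oneLp π), oneLp_ae (π := π),
    ae_ae_of_invariant hinv (oneLp_ae (π := π))] with x h1 h2 h3
  rw [h1, h2, integral_congr_ae h3]
  simp

/-- On the atom `P g` is almost everywhere the constant `ν(g)`, which factors out of the integral.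
-/
theorem inner_indicator_L2Op_eq_zero (hinv : P.Invariant π) (hA : IsAccessibleAtom P π A)
    {f : Lp ℝ 2 π} (hf : ∫ x in A, f x ∂π = 0) (g : Lp ℝ 2 π) :
    inner ℝ (((Lp.memLp f).indicator hA.measurableSet).toLp _) (L2Op hinv g) = 0 := by
  obtain ⟨ν, _, hν⟩ := hA.atom
  have hPν : ∀ x ∈ A, P x = ν := fun x hx => Measure.ext fun B hB => hν x hx B hB
  rw [real_inner_eq_integral]
  have h1 : ∫ x, ((Lp.memLp f).indicator hA.measurableSet).toLp _ x * L2Op hinv g x ∂π =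
      ∫ x, A.indicator (fun x => f x * ∫ y, g y ∂ν) x ∂π := by
    refine integral_congr_ae ?_
    filter_upwards [L2Op_ae hinv g, ((Lp.memLp f).indicator hA.measurableSet).coeFn_toLp]
      with x hx1 hx2
    rw [hx1, hx2]
    by_cases hx : x ∈ A
    · simp [hx, hPν x hx]
    · simp [hx]
  rw [h1, integral_indicator hA.measurableSet, integral_mul_const, hf, zero_mul]

/-- Positivity of the kernel allows replacing `f` by `|f|`, where the estimate for nonnegative
functions applies. -/
theorem inner_L2Op_indicator_compl_le (hrev : P.IsReversible π) (hA : MeasurableSet A)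
    (hκ : 1 < κ) (hV : ∀ᵐ x ∂π, tailSeries P A κ x < ⊤)
    (hVA : (⨆ x ∈ A, tailSeries P A κ x) < ⊤) (f : Lp ℝ 2 π) :
    κ * inner ℝ (((Lp.memLp f).indicator hA.compl).toLp _)
      (L2Op hrev.invariant (((Lp.memLp f).indicator hA.compl).toLp _)) ≤ ‖f‖ ^ 2 := by
  set g : Lp ℝ 2 π := ((Lp.memLp f).indicator hA.compl).toLp _ with hg
  have hgae : g =ᵐ[π] Aᶜ.indicator f := MemLp.coeFn_toLp _
  set F : X → ℝ≥0∞ := fun x => ‖f x‖ₑ with hF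
  have hFm : Measurable F := (Lp.stronglyMeasurable f).measurable.enorm
  rw [← ENNReal.ofReal_le_ofReal_iff (sq_nonneg _), ENNReal.ofReal_mul (by linarith)]
  calc ENNReal.ofReal κ * ENNReal.ofReal (inner ℝ g (L2Op hrev.invariant g))
      ≤ ENNReal.ofReal κ * ∫⁻ x in Aᶜ, F x * tabooOp P A F x ∂π := by
        gcongr
        rw [real_inner_eq_integral]
        refine (ENNReal.ofReal_le_ofReal (le_abs_self _)).trans ?_
        rw [← Real.enorm_eq_ofReal_abs]
        refine (enorm_integral_le_lintegral_enorm _).trans ?_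
        rw [← lintegral_indicator hA.compl]
        refine lintegral_mono_ae ?_
        filter_upwards [hgae, L2Op_ae hrev.invariant g, ae_ae_of_invariant hrev.invariant hgae]
          with x h1 h2 h3
        rw [h1, h2, integral_congr_ae h3]
        by_cases hx : x ∈ A
        · simp [hx]
        · have hx' : x ∈ Aᶜ := hx
          rw [Set.indicator_of_mem hx', Set.indicator_of_mem hx', enorm_mul]
          gcongr
          refine (enorm_integral_le_lintegral_enorm _).trans_eq ?_
          rw [tabooOp_eq_indicator hA]
          refine lintegral_congr fun y => ?_
          by_cases hy : y ∈ A <;> simp [hy, hF]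
    _ ≤ ∫⁻ x in Aᶜ, F x ^ 2 ∂π := setLIntegral_mul_tabooOp_le hrev hA hκ hV hVA hFm
    _ ≤ ∫⁻ x, F x ^ 2 ∂π := setLIntegral_le_lintegral _ _
    _ = ENNReal.ofReal (‖f‖ ^ 2) := by
        rw [norm_sq_eq_integral, ofReal_integral_eq_lintegral_ofReal (integrable_norm_sq f)
          (.of_forall fun x => sq_nonneg _)]
        refine lintegral_congr fun x => ?_
        rw [ENNReal.ofReal_pow (norm_nonneg _), ofReal_norm]

/-- The part of `f` on `A` is orthogonal to the range of `P`; by self-adjointness it drops out of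
both slots of the form. -/
theorem inner_L2Op_le_of_setIntegral_eq_zero (hrev : P.IsReversible π)
    (hA : IsAccessibleAtom P π A) (hκ : 1 < κ) (hV : ∀ᵐ x ∂π, tailSeries P A κ x < ⊤)
    (hVA : (⨆ x ∈ A, tailSeries P A κ x) < ⊤) {f : Lp ℝ 2 π} (hf : ∫ x in A, f x ∂π = 0) :
    κ * inner ℝ f (L2Op hrev.invariant f) ≤ ‖f‖ ^ 2 := by
  have hAm := hA.measurableSet
  set f₁ : Lp ℝ 2 π := ((Lp.memLp f).indicator hAm).toLp _ with hf₁
  set f₂ : Lp ℝ 2 π := ((Lp.memLp f).indicator hAm.compl).toLp _ with hf₂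
  have hsum : f = f₁ + f₂ := by
    refine Lp.ext ?_
    filter_upwards [Lp.coeFn_add f₁ f₂, ((Lp.memLp f).indicator hAm).coeFn_toLp,
      ((Lp.memLp f).indicator hAm.compl).coeFn_toLp] with x h1 h2 h3
    rw [h1, Pi.add_apply, h2, h3, Set.indicator_self_add_compl_apply]
  have h0 : ∀ g, inner ℝ f₁ (L2Op hrev.invariant g) = 0 :=
    inner_indicator_L2Op_eq_zero hrev.invariant hA hf
  have : inner ℝ f (L2Op hrev.invariant f) = inner ℝ f₂ (L2Op hrev.invariant f₂) := by
    have h1 : inner ℝ f (L2Op hrev.invariant f) = inner ℝ f₂ (L2Op hrev.invariant f) := by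
      conv_lhs => rw [hsum, inner_add_left, ← hsum, h0, zero_add]
    rw [h1, inner_L2Op_comm hrev, real_inner_comm]
    conv_lhs => rw [hsum, inner_add_left, h0, zero_add]
  rw [this]
  exact inner_L2Op_indicator_compl_le hrev hAm hκ hV hVA f

/-- Adding the constant `c` that makes the integral over `A` vanish changes both the form and the
squared norm by exactly `c²`, since constants are fixed by `P` and orthogonal to `f`. As `κ ≥ 1`,
the term `κ c²` absorbs `c²`. -/
theorem inner_L2Op_le (hrev : P.IsReversible π)
    (hA : IsAccessibleAtom P π A) (hκ : 1 < κ) (hV : ∀ᵐ x ∂π, tailSeries P A κ x < ⊤)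
    (hVA : (⨆ x ∈ A, tailSeries P A κ x) < ⊤) {f : Lp ℝ 2 π} (hf : f ∈ meanZero ℝ π) :
    κ * inner ℝ f (L2Op hrev.invariant f) ≤ ‖f‖ ^ 2 := by
  have hf0 : ∫ x, f x ∂π = 0 := hf
  have hπA : π.real A ≠ 0 := (ENNReal.toReal_pos hA.pos.ne' (measure_ne_top _ _)).ne'
  set c : ℝ := -(∫ x in A, f x ∂π) / π.real A with hc
  set e := oneLp π with he
  have hg : ∫ x in A, (f + c • e : Lp ℝ 2 π) x ∂π = 0 := by
    have : ∫ x in A, (f + c • e : Lp ℝ 2 π) x ∂π = ∫ x in A, (f x + c) ∂π := by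
      refine integral_congr_ae (ae_restrict_of_ae ?_)
      filter_upwards [Lp.coeFn_add f (c • e), Lp.coeFn_smul c e, oneLp_ae (π := π)] with x h1 h2 h3
      rw [h1, Pi.add_apply, h2, Pi.smul_apply, h3, smul_eq_mul, mul_one]
    rw [this, integral_add ((Lp.memLp f).integrable one_le_two).integrableOn (integrable_const c),
      setIntegral_const, smul_eq_mul, hc]
    field_simp
    ring
  have hmain := inner_L2Op_le_of_setIntegral_eq_zero hrev hA hκ hV hVA hg
  have hef : inner ℝ e f = 0 := (inner_oneLp f).trans hf0
  have hTe : L2Op hrev.invariant e = e := L2Op_oneLp _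
  have heTf : inner ℝ e (L2Op hrev.invariant f) = 0 := by
    rw [inner_L2Op_comm hrev, hTe, hef]
  have hee : inner ℝ e e = 1 := by
    rw [he, inner_oneLp, integral_congr_ae oneLp_ae]
    simp
  have h1 : inner ℝ (f + c • e) (L2Op hrev.invariant (f + c • e)) =
      inner ℝ f (L2Op hrev.invariant f) + c ^ 2 := by
    rw [map_add, map_smul, hTe]
    simp only [inner_add_left, inner_add_right, inner_smul_left, inner_smul_right, heTf, hee,
      real_inner_comm e f, hef, RCLike.conj_to_real]
    ring
  have h2 : ‖f + c • e‖ ^ 2 = ‖f‖ ^ 2 + c ^ 2 := by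
    rw [← real_inner_self_eq_norm_sq, ← real_inner_self_eq_norm_sq]
    simp only [inner_add_left, inner_add_right, inner_smul_left, inner_smul_right, hee,
      real_inner_comm e f, hef, RCLike.conj_to_real]
    ring
  rw [h1, h2] at hmain
  nlinarith [sq_nonneg c]

/-- With `T` the operator, non-negativity of the form at `f - κ T f` reads `2κ ‖T f‖² ≤ ⟨f, T f⟩ +
κ² ⟨T f, T² f⟩`. The form bound at `f` and at `T f` makes the right side at most `κ⁻¹ ‖f‖² + κ ‖T
f‖²`. -/
theorem mul_norm_L2Op_le_real (hrev : P.IsReversible π) (hnonneg : IsNonnegDefinite P π)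
    (hA : IsAccessibleAtom P π A) (hκ : 1 < κ) (hV : ∀ᵐ x ∂π, tailSeries P A κ x < ⊤)
    (hVA : (⨆ x ∈ A, tailSeries P A κ x) < ⊤) {f : Lp ℝ 2 π} (hf : f ∈ meanZero ℝ π) :
    κ ^ 2 * ‖L2Op hrev.invariant f‖ ^ 2 ≤ ‖f‖ ^ 2 := by
  set T : Lp ℝ 2 π →L[ℝ] Lp ℝ 2 π := L2Op hrev.invariant with hT
  have h1 := inner_L2Op_le hrev hA hκ hV hVA hf
  have h2 := inner_L2Op_le hrev hA hκ hV hVA (L2Op_mem_meanZero hrev.invariant f hf)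
  have h3 := inner_L2Op_nonneg hrev.invariant hnonneg (f - κ • T f)
  rw [← hT] at h1 h2 h3
  have h4 : inner ℝ (f - κ • T f) (T (f - κ • T f)) =
      inner ℝ f (T f) - 2 * κ * ‖T f‖ ^ 2 + κ ^ 2 * inner ℝ (T f) (T (T f)) := by
    have h5 : inner ℝ f (T (T f)) = ‖T f‖ ^ 2 := by
      rw [hT, inner_L2Op_comm hrev, real_inner_self_eq_norm_sq]
    rw [map_sub, map_smul]
    simp only [inner_sub_left, inner_sub_right, inner_smul_left, inner_smul_right, h5,
      real_inner_self_eq_norm_sq, RCLike.conj_to_real]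
    ring
  rw [h4] at h3
  have h6 : κ ^ 2 * (κ * inner ℝ (T f) (T (T f))) ≤ κ ^ 2 * ‖T f‖ ^ 2 := by gcongr
  have h7 : 0 ≤ κ * (inner ℝ f (T f) - 2 * κ * ‖T f‖ ^ 2 + κ ^ 2 * inner ℝ (T f) (T (T f))) :=
    mul_nonneg (by linarith) h3
  nlinarith

variable {𝕜 : Type*} [RCLike 𝕜]

theorem L2Op_compLp_ae (hinv : P.Invariant π) (L : 𝕜 →L[ℝ] ℝ) (f : Lp 𝕜 2 π) :
    L2Op hinv (L.compLp f) =ᵐ[π] fun x => L (L2Op hinv f x) := by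
  filter_upwards [L2Op_ae hinv (L.compLp f), L2Op_ae hinv f, ae_integrable hinv f,
    ae_ae_of_invariant hinv (L.coeFn_compLp f)] with x h1 h2 h3 h4
  rw [h1, h2, integral_congr_ae h4, L.integral_comp_comm h3]

theorem compLp_mem_meanZero (L : 𝕜 →L[ℝ] ℝ) {f : Lp 𝕜 2 π} (hf : f ∈ meanZero 𝕜 π) :
    L.compLp f ∈ meanZero ℝ π := by
  have hf0 : ∫ x, f x ∂π = 0 := hf
  change ∫ x, L.compLp f x ∂π = 0
  rw [integral_congr_ae (L.coeFn_compLp f),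
    L.integral_comp_comm ((Lp.memLp f).integrable one_le_two), hf0, map_zero]

/-- The operator commutes with real and imaginary parts, so the real bound applies to each. -/
theorem mul_norm_L2Op_le (hrev : P.IsReversible π) (hnonneg : IsNonnegDefinite P π)
    (hA : IsAccessibleAtom P π A) (hκ : 1 < κ) (hV : ∀ᵐ x ∂π, tailSeries P A κ x < ⊤)
    (hVA : (⨆ x ∈ A, tailSeries P A κ x) < ⊤) {f : Lp 𝕜 2 π} (hf : f ∈ meanZero 𝕜 π) :
    κ * ‖L2Op hrev.invariant f‖ ≤ ‖f‖ := by
  refine le_of_sq_le_sq ?_ (norm_nonneg _)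
  have hre : RCLike.reCLM.compLp f =ᵐ[π] fun x => RCLike.re (f x) :=
    (RCLike.reCLM (K := 𝕜)).coeFn_compLp f
  have him : RCLike.imCLM.compLp f =ᵐ[π] fun x => RCLike.im (f x) :=
    (RCLike.imCLM (K := 𝕜)).coeFn_compLp f
  rw [mul_pow, norm_sq_eq_re_add_im f hre him,
    norm_sq_eq_re_add_im _ (L2Op_compLp_ae hrev.invariant RCLike.reCLM f)
      (L2Op_compLp_ae hrev.invariant RCLike.imCLM f), mul_add]
  exact add_le_add
    (mul_norm_L2Op_le_real hrev hnonneg hA hκ hV hVA (compLp_mem_meanZero _ hf))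
    (mul_norm_L2Op_le_real hrev hnonneg hA hκ hV hVA (compLp_mem_meanZero _ hf))

theorem isClosed_meanZero : IsClosed (meanZero 𝕜 π : Set (Lp 𝕜 2 π)) := by
  have : (meanZero 𝕜 π : Set (Lp 𝕜 2 π)) =
      {f | inner 𝕜 (indicatorConstLp 2 MeasurableSet.univ (measure_ne_top π _) (1 : 𝕜)) f = 0} := by
    ext f
    rw [Set.mem_ofPred_eq, L2.inner_indicatorConstLp_one, Measure.restrict_univ]
    rfl
  rw [this]
  exact isClosed_eq (continuous_const.inner continuous_id) continuous_const

theorem spectralRadius_meanZeroOp_le (hrev : P.IsReversible π) (hnonneg : IsNonnegDefinite P π)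
    (hA : IsAccessibleAtom P π A) (hκ : 1 < κ) (hV : ∀ᵐ x ∂π, tailSeries P A κ x < ⊤)
    (hVA : (⨆ x ∈ A, tailSeries P A κ x) < ⊤) :
    r₀ 𝕜 hrev.invariant ≤ ENNReal.ofReal κ⁻¹ := by
  have hκ0 : 0 < κ := by linarith
  have : CompleteSpace (meanZero 𝕜 π) := isClosed_meanZero.completeSpace_coe
  refine spectralRadius_le_of_norm_le (ContinuousLinearMap.opNorm_le_bound _ (by positivity)
    fun f => ?_)
  rw [inv_mul_eq_div, le_div_iff₀ hκ0, mul_comm]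
  exact mul_norm_L2Op_le hrev hnonneg hA hκ hV hVA f.2

end L2

/-! ### Iterates of `P` and total variation bounds. -/

section Iterates

theorem integrable_of_abs_le {μ : Measure X} [IsFiniteMeasure μ] {f : X → ℝ} (hf : Measurable f)
    {M : ℝ} (hM : ∀ x, |f x| ≤ M) : Integrable f μ :=
  .of_bound hf.aestronglyMeasurable M (.of_forall hM)

theorem measurable_integral_pow {P : Kernel X X} {f : X → ℝ} (hf : Measurable f) (n : ℕ) :
    Measurable fun x => ∫ y, f y ∂((P ^ n) x) :=
  (hf.stronglyMeasurable.integral_kernel (κ := P ^ n)).measurable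

variable {P : Kernel X X} [IsMarkovKernel P] {π : Measure X} [IsProbabilityMeasure π] {A : Set X}
  {κ : ℝ}

instance isMarkovKernel_pow (n : ℕ) : IsMarkovKernel (P ^ n) := by
  induction n with
  | zero => exact inferInstanceAs (IsMarkovKernel (Kernel.id : Kernel X X))
  | succ n ih =>
    rw [pow_succ]
    exact inferInstanceAs (IsMarkovKernel ((P ^ n) ∘ₖ P))

theorem abs_integral_pow_le {f : X → ℝ} {M : ℝ} (hM : ∀ x, |f x| ≤ M) (n : ℕ) (x : X) :
    |∫ y, f y ∂((P ^ n) x)| ≤ M := by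
  have := norm_integral_le_of_norm_le_const (μ := (P ^ n) x) (f := f) (C := M) (.of_forall hM)
  simpa using this

theorem integral_pow_succ {f : X → ℝ} (hf : Measurable f) {M : ℝ} (hM : ∀ x, |f x| ≤ M)
    (n : ℕ) (x : X) :
    ∫ y, f y ∂((P ^ (n + 1)) x) = ∫ y, ∫ z, f z ∂((P ^ n) y) ∂(P x) := by
  have h : P ^ (n + 1) = (P ^ n) ∘ₖ P := pow_succ P n
  rw [h, Kernel.integral_comp (integrable_of_abs_le hf hM)]

theorem L2Op_pow_ae (hinv : P.Invariant π) {f : X → ℝ} (hf : Measurable f) {M : ℝ}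
    (hM : ∀ x, |f x| ≤ M) {g : Lp ℝ 2 π} (hg : g =ᵐ[π] f) (n : ℕ) :
    (L2Op hinv ^ n) g =ᵐ[π] fun x => ∫ y, f y ∂((P ^ n) x) := by
  induction n with
  | zero =>
    refine hg.trans (.of_forall fun x => ?_)
    change f x = ∫ y, f y ∂((Kernel.id : Kernel X X) x)
    rw [Kernel.id_apply, integral_dirac' _ _ hf.stronglyMeasurable]
  | succ n ih =>
    rw [pow_succ']
    filter_upwards [L2Op_ae hinv ((L2Op hinv ^ n) g), ae_ae_of_invariant hinv ih] with x h1 h2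
    rw [integral_pow_succ hf hM, ← integral_congr_ae h2, ← h1]
    rfl

theorem norm_L2Op_pow_le (hinv : P.Invariant π) (hκ : 0 < κ)
    (hT : ∀ f ∈ meanZero ℝ π, κ * ‖L2Op hinv f‖ ≤ ‖f‖) {g : Lp ℝ 2 π} (hg : g ∈ meanZero ℝ π)
    (n : ℕ) : (L2Op hinv ^ n) g ∈ meanZero ℝ π ∧ ‖(L2Op hinv ^ n) g‖ ≤ κ⁻¹ ^ n * ‖g‖ := by
  induction n with
  | zero => exact ⟨hg, by simp⟩
  | succ n ih =>
    rw [pow_succ']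
    refine ⟨L2Op_mem_meanZero hinv _ ih.1, ?_⟩
    change ‖L2Op hinv ((L2Op hinv ^ n) g)‖ ≤ _
    calc ‖L2Op hinv ((L2Op hinv ^ n) g)‖ ≤ κ⁻¹ * ‖(L2Op hinv ^ n) g‖ := by
          rw [inv_mul_eq_div, le_div_iff₀ hκ, mul_comm]
          exact hT _ ih.1
      _ ≤ κ⁻¹ * (κ⁻¹ ^ n * ‖g‖) := by
          gcongr
          exact ih.2
      _ = κ⁻¹ ^ (n + 1) * ‖g‖ := by ring

theorem norm_indicatorConstLp_sub_sq (hA : MeasurableSet A) :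
    ‖indicatorConstLp 2 hA (measure_ne_top π A) (1 : ℝ) - π.real A • oneLp π‖ ^ 2 =
      π.real A - π.real A ^ 2 := by
  set i := indicatorConstLp 2 hA (measure_ne_top π A) (1 : ℝ) with hi
  have hii : inner ℝ i i = π.real A := by
    rw [hi, L2.real_inner_indicatorConstLp_one_indicatorConstLp_one hA hA, Set.inter_self]
  have hie : inner ℝ i (oneLp π) = π.real A := by
    rw [hi, L2.inner_indicatorConstLp_one, setIntegral_congr_ae hA (g := fun _ => (1 : ℝ))]
    · simp
    · filter_upwards [oneLp_ae (π := π)] with x hx _ using hx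
  have hee : inner ℝ (oneLp π) (oneLp π) = 1 := by
    rw [inner_oneLp, integral_congr_ae oneLp_ae]
    simp
  rw [← real_inner_self_eq_norm_sq]
  simp only [inner_sub_left, inner_sub_right, inner_smul_left, inner_smul_right, hii, hie, hee,
    real_inner_comm i, RCLike.conj_to_real]
  ring

/-- The pointwise value at `a` is read off from an `L²` pairing with `1_A`. Subtracting the constant
`π(A)` from `1_A` leaves the pairing unchanged, the other factor having mean zero, and yields the
factor `π(A)⁻¹ - 1` in place of `π(A)⁻¹`. -/
theorem abs_integral_pow_sub_le (hinv : P.Invariant π) (hA : IsAccessibleAtom P π A) (hκ : 0 < κ)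
    (hT : ∀ f ∈ meanZero ℝ π, κ * ‖L2Op hinv f‖ ≤ ‖f‖) {f : X → ℝ} (hf : Measurable f)
    (hf1 : ∀ x, |f x| ≤ 1) (n : ℕ) {a : X} (ha : a ∈ A) :
    |∫ y, f y ∂((P ^ (n + 1)) a) - ∫ y, f y ∂π| ≤
      Real.sqrt ((π.real A)⁻¹ - 1) * κ⁻¹ ^ (n + 1) := by
  have hAm := hA.measurableSet
  have hp : 0 < π.real A := ENNReal.toReal_pos hA.pos.ne' (measure_ne_top _ _)
  set p := π.real A with hpdef
  set m := ∫ y, f y ∂π with hm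
  have hfi : Integrable f π := integrable_of_abs_le hf hf1
  have hm1 : |m| ≤ 1 := by
    have := norm_integral_le_of_norm_le_const (μ := π) (f := f) (C := 1) (.of_forall hf1)
    simpa using this
  have hfm : Measurable fun x => f x - m := hf.sub_const m
  have hfb : ∀ x, |f x - m| ≤ 2 := fun x => by
    have := abs_sub (f x) m
    linarith [hf1 x]
  have hLp : MemLp (fun x => f x - m) 2 π :=
    MemLp.of_bound hfm.aestronglyMeasurable 2 (.of_forall hfb)
  set g : Lp ℝ 2 π := hLp.toLp _ with hg
  have hgae : g =ᵐ[π] fun x => f x - m := hLp.coeFn_toLp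
  have hg0 : g ∈ meanZero ℝ π := by
    change ∫ x, g x ∂π = 0
    rw [integral_congr_ae hgae, integral_sub hfi (integrable_const m)]
    simp [hm]
  -- The variance of `f` is at most its second moment, hence at most `1`.
  have hgn : ‖g‖ ≤ 1 := by
    refine le_of_sq_le_sq ?_ zero_le_one
    have hf2 : Integrable (fun x => f x ^ 2) π :=
      integrable_of_abs_le (hf.pow_const 2) (M := 1) fun x => by
        rw [abs_pow]
        exact pow_le_one₀ (abs_nonneg _) (hf1 x)
    have h1 : ‖g‖ ^ 2 = ∫ x, (f x ^ 2 - 2 * m * f x + m ^ 2) ∂π := by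
      rw [norm_sq_eq_integral]
      refine integral_congr_ae ?_
      filter_upwards [hgae] with x hx
      rw [hx, Real.norm_eq_abs, sq_abs]
      ring
    have h2 : ∫ x, f x ^ 2 ∂π ≤ 1 := by
      calc ∫ x, f x ^ 2 ∂π ≤ ∫ _, (1 : ℝ) ∂π :=
            integral_mono hf2 (integrable_const _) fun x => (sq_le_one_iff_abs_le_one _).2 (hf1 x)
        _ = 1 := by simp
    have hfc : Integrable (fun x => 2 * m * f x) π := hfi.const_mul _
    have h3 : ∫ x, (f x ^ 2 - 2 * m * f x + m ^ 2) ∂π = ∫ x, f x ^ 2 ∂π - 2 * m * m + m ^ 2 := by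
      have hsub : Integrable (fun x => f x ^ 2 - 2 * m * f x) π := hf2.sub hfc
      rw [integral_add hsub (integrable_const _), integral_sub hf2 hfc, integral_const_mul]
      simp [hm]
    rw [h1, h3]
    nlinarith [sq_nonneg m]
  obtain ⟨hTm, hTn⟩ := norm_L2Op_pow_le hinv hκ hT hg0 (n + 1)
  have hTae := L2Op_pow_ae hinv hfm hfb hgae (n + 1)
  set h := (L2Op hinv ^ (n + 1)) g with hh
  obtain ⟨ν, _, hν⟩ := hA.atom
  have hPν : ∀ x ∈ A, P x = ν := fun x hx => Measure.ext fun B hB => hν x hx B hB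
  -- The atom equates the laws of the first step only, hence the exponent `n + 1`.
  have hconst : ∀ x ∈ A, ∫ y, (f y - m) ∂((P ^ (n + 1)) x) =
      ∫ y, f y ∂((P ^ (n + 1)) a) - m := by
    intro x hx
    rw [integral_pow_succ hfm hfb, hPν x hx, ← hPν a ha, ← integral_pow_succ hfm hfb,
      integral_sub (integrable_of_abs_le hf hf1) (integrable_const m)]
    simp
  set d := ∫ y, f y ∂((P ^ (n + 1)) a) - m with hd
  set i := indicatorConstLp 2 hAm (measure_ne_top π A) (1 : ℝ) with hi
  have h1 : inner ℝ (i - p • oneLp π) h = p * d := by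
    have h0 : ∫ x, h x ∂π = 0 := hTm
    rw [inner_sub_left, inner_smul_left, inner_oneLp, h0, mul_zero, sub_zero, hi,
      L2.inner_indicatorConstLp_one, setIntegral_congr_ae hAm (g := fun _ => d)]
    · simp [hpdef]
    · filter_upwards [hTae] with x hx hxA
      rw [hx, hconst x hxA]
  have h2 : |p * d| ≤ ‖i - p • oneLp π‖ * κ⁻¹ ^ (n + 1) := by
    rw [← h1]
    calc |inner ℝ (i - p • oneLp π) h| ≤ ‖i - p • oneLp π‖ * ‖h‖ := abs_real_inner_le_norm _ _
      _ ≤ ‖i - p • oneLp π‖ * (κ⁻¹ ^ (n + 1) * 1) := by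
          gcongr
          exact hTn.trans (by gcongr)
      _ = _ := by rw [mul_one]
  have h3 : ‖i - p • oneLp π‖ = p * Real.sqrt (p⁻¹ - 1) := by
    rw [← Real.sqrt_sq (norm_nonneg _), norm_indicatorConstLp_sub_sq hAm]
    rw [← Real.sqrt_sq hp.le, ← Real.sqrt_mul (sq_nonneg _), Real.sqrt_sq hp.le]
    congr 1
    rw [← hpdef]
    field_simp
  rw [h3, abs_mul, abs_of_pos hp, mul_assoc] at h2
  exact le_of_mul_le_mul_left h2 hp

theorem varDist_le {μ ν : Measure X} {c : ℝ≥0∞}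
    (h : ∀ f : X → ℝ, Measurable f → (∀ x, |f x| ≤ 1) →
      ‖∫ x, f x ∂μ - ∫ x, f x ∂ν‖ₑ ≤ c) : varDist μ ν ≤ c :=
  iSup_le fun f => iSup_le fun hf => iSup_le fun hf1 => by
    rw [← Real.enorm_eq_ofReal_abs]
    exact h f hf hf1

theorem le_varDist {μ ν : Measure X} {f : X → ℝ} (hf : Measurable f) (hf1 : ∀ x, |f x| ≤ 1) :
    ‖∫ x, f x ∂μ - ∫ x, f x ∂ν‖ₑ ≤ varDist μ ν := by
  rw [Real.enorm_eq_ofReal_abs]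
  exact le_iSup_of_le f (le_iSup_of_le hf (le_iSup_of_le hf1 le_rfl))

theorem varDist_le_two (μ ν : Measure X) [IsProbabilityMeasure μ] [IsProbabilityMeasure ν] :
    varDist μ ν ≤ 2 := by
  refine varDist_le fun f _ hf1 => ?_
  have key : ∀ (ρ : Measure X) [IsProbabilityMeasure ρ], |∫ x, f x ∂ρ| ≤ 1 := fun ρ _ => by
    have := norm_integral_le_of_norm_le_const (μ := ρ) (f := f) (C := 1) (.of_forall hf1)
    simpa using this
  rw [Real.enorm_eq_ofReal_abs, show (2 : ℝ≥0∞) = ENNReal.ofReal 2 by simp]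
  refine ENNReal.ofReal_le_ofReal ((abs_sub _ _).trans ?_)
  linarith [key μ, key ν]

/-- First-entrance argument: a geometric bound on `A` propagates to all starting points, with a
constant proportional to the generating series of the return time tail. -/
theorem varDist_pow_le_tailSeries (hA : MeasurableSet A) (hκ : 1 < κ) {B : ℝ≥0∞} (hB : 2 ≤ B)
    (hBA : ∀ n, ∀ a ∈ A, varDist ((P ^ n) a) π ≤ B * ENNReal.ofReal κ⁻¹ ^ n) (n : ℕ) :
    ∀ x, varDist ((P ^ n) x) π ≤
      ENNReal.ofReal κ * B * tailSeries P A κ x * ENNReal.ofReal κ⁻¹ ^ n := by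
  have hκ0 : 0 < κ := by linarith
  have hk1 : 1 ≤ ENNReal.ofReal κ := by simpa using hκ.le
  have hcancel : ENNReal.ofReal κ * ENNReal.ofReal κ⁻¹ = 1 := by
    rw [← ENNReal.ofReal_mul hκ0.le, mul_inv_cancel₀ hκ0.ne', ENNReal.ofReal_one]
  set K := ENNReal.ofReal κ
  set R := ENNReal.ofReal κ⁻¹
  set V := tailSeries P A κ
  have hVm : Measurable V := measurable_tailSeries hA
  induction n with
  | zero =>
    intro x
    have hV1 : 1 ≤ V x := by
      rw [show V x = 1 + K * tabooOp P A V x from tailSeries_eq hA x]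
      exact le_self_add
    calc varDist ((P ^ 0) x) π ≤ 2 := varDist_le_two _ _
      _ ≤ 1 * B * 1 * R ^ 0 := by simpa using hB
      _ ≤ K * B * V x * R ^ 0 := by gcongr
  | succ n ih =>
    intro x
    refine varDist_le fun f hf hf1 => ?_
    set m := ∫ y, f y ∂π
    have hrw : ∫ y, f y ∂((P ^ (n + 1)) x) - m = ∫ y, (∫ z, f z ∂((P ^ n) y) - m) ∂(P x) := by
      rw [integral_pow_succ hf hf1, integral_sub (integrable_of_abs_le
        (measurable_integral_pow hf n) (abs_integral_pow_le hf1 n)) (integrable_const m)]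
      simp
    rw [hrw]
    calc ‖∫ y, (∫ z, f z ∂((P ^ n) y) - m) ∂(P x)‖ₑ
        ≤ ∫⁻ y, ‖∫ z, f z ∂((P ^ n) y) - m‖ₑ ∂(P x) := enorm_integral_le_lintegral_enorm _
      _ = ∫⁻ y in A, ‖∫ z, f z ∂((P ^ n) y) - m‖ₑ ∂(P x) +
          ∫⁻ y in Aᶜ, ‖∫ z, f z ∂((P ^ n) y) - m‖ₑ ∂(P x) := (lintegral_add_compl _ hA).symm
      -- After one step, a chain in `A` obeys the atom bound and a chain outside obeys the induction
      -- hypothesis.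
      _ ≤ ∫⁻ _ in A, B * R ^ n ∂(P x) + ∫⁻ y in Aᶜ, K * B * R ^ n * V y ∂(P x) := by
          refine add_le_add (setLIntegral_mono' hA fun y hy => ?_)
            (lintegral_mono fun y => ?_)
          · exact (le_varDist hf hf1).trans (hBA n y hy)
          · exact ((le_varDist hf hf1).trans (ih y)).trans_eq (by ring)
      _ ≤ B * R ^ n + K * B * R ^ n * tabooOp P A V x := by
          rw [lintegral_const, Measure.restrict_apply_univ, lintegral_const_mul _ hVm]
          exact add_le_add (mul_le_of_le_one_right zero_le prob_le_one) le_rfl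
      -- Inserting `K * R = 1` supplies the extra factor `R`; the two terms then recombine through
      -- `V = 1 + κ Q V`.
      _ = (K * R) * (B * R ^ n) + (K * R) * (K * B * R ^ n * tabooOp P A V x) := by
          rw [hcancel, one_mul, one_mul]
      _ = K * B * V x * R ^ (n + 1) := by
          rw [show V x = 1 + K * tabooOp P A V x from tailSeries_eq hA x]
          ring

end Iterates

end MarkovChain


theorem proposition3p2 {X : Type*} [MeasurableSpace X] [MeasurableSpace.CountablyGenerated X]
    (P : Kernel X X) [IsMarkovKernel P] (π : Measure X) [IsProbabilityMeasure π]
    (hirr : Kernel.IsIrreducible π P)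
    (hrev : P.IsReversible π) (hnonneg : MarkovChain.IsNonnegDefinite P π)
    (A : Set X) (hA : MarkovChain.IsAccessibleAtom P π A)
    (κ : ℝ) (hκ : 1 < κ)
    (hL : (⨆ x ∈ A, MarkovChain.geomMoment P A κ x) < ⊤) :
    -- the spectral radius bound, on the real and on the complex mean-zero space
    (MarkovChain.r₀ ℝ hrev.invariant ≤ ENNReal.ofReal κ⁻¹ ∧
      MarkovChain.r₀ ℂ hrev.invariant ≤ ENNReal.ofReal κ⁻¹) ∧
    (∀ n : ℕ, 1 ≤ n →
      (⨆ x ∈ A, MarkovChain.varDist ((P ^ n) x) π) ≤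
        ENNReal.ofReal (Real.sqrt ((π.real A)⁻¹ - 1) * (κ⁻¹) ^ n)) ∧
    (∃ C : X → ℝ, ∀ᵐ x ∂π, ∀ n : ℕ,
      MarkovChain.varDist ((P ^ n) x) π ≤ ENNReal.ofReal (C x * (κ⁻¹) ^ n)) := by
  have hκ0 : 0 < κ := by linarith
  have hAm := hA.measurableSet
  have hne : A.Nonempty := nonempty_of_measure_ne_zero hA.pos.ne'
  have hVA := MarkovChain.iSup_tailSeries_lt_top hAm hκ hL
  have hV := MarkovChain.ae_tailSeries_lt_top (π := π) hAm hne hκ0 hVA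
  have hatom : ∀ n : ℕ, 1 ≤ n → ∀ a ∈ A, MarkovChain.varDist ((P ^ n) a) π ≤
      ENNReal.ofReal (Real.sqrt ((π.real A)⁻¹ - 1) * (κ⁻¹) ^ n) := by
    intro n hn a ha
    obtain ⟨k, rfl⟩ := Nat.exists_eq_add_of_le' hn
    refine MarkovChain.varDist_le fun f hf hf1 => ?_
    rw [Real.enorm_eq_ofReal_abs]
    exact ENNReal.ofReal_le_ofReal (MarkovChain.abs_integral_pow_sub_le hrev.invariant hA hκ0
      (fun g hg => MarkovChain.mul_norm_L2Op_le hrev hnonneg hA hκ hV hVA hg) hf hf1 k ha)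
  refine ⟨⟨MarkovChain.spectralRadius_meanZeroOp_le hrev hnonneg hA hκ hV hVA,
    MarkovChain.spectralRadius_meanZeroOp_le hrev hnonneg hA hκ hV hVA⟩,
    fun n hn => iSup₂_le (hatom n hn), ?_⟩
  -- The atom bound starts at `n = 1`; the value `2` covers `n = 0`.
  set B : ℝ≥0∞ := max 2 (ENNReal.ofReal (Real.sqrt ((π.real A)⁻¹ - 1))) with hB
  have hBtop : B ≠ ⊤ := by simp [hB]
  have hBA : ∀ n, ∀ a ∈ A, MarkovChain.varDist ((P ^ n) a) π ≤ B * ENNReal.ofReal κ⁻¹ ^ n := by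
    intro n a ha
    rcases Nat.eq_zero_or_pos n with rfl | hn
    · rw [pow_zero (ENNReal.ofReal κ⁻¹), mul_one]
      exact (MarkovChain.varDist_le_two _ _).trans (le_max_left _ _)
    · refine (hatom n hn a ha).trans ?_
      rw [ENNReal.ofReal_mul (Real.sqrt_nonneg _), ENNReal.ofReal_pow (by positivity)]
      gcongr
      exact le_max_right _ _
  -- Where the series diverges `toReal` returns `0`, but this happens only on a null set.
  refine ⟨fun x => (ENNReal.ofReal κ * B * MarkovChain.tailSeries P A κ x).toReal, ?_⟩
  filter_upwards [hV] with x hx n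
  rw [ENNReal.ofReal_mul ENNReal.toReal_nonneg, ENNReal.ofReal_toReal (ENNReal.mul_ne_top
    (ENNReal.mul_ne_top ENNReal.ofReal_ne_top hBtop) hx.ne), ENNReal.ofReal_pow (by positivity)]
  exact MarkovChain.varDist_pow_le_tailSeries hAm hκ (le_max_left _ _) hBA n x
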